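/- Let $Q\in L^1_{\mathrm{loc}}(]0,\infty[)$ be complex-valued and, for $m\in\mathbb{C}$, let $$L_{m^2}=-\partial_x^2+\Big(m^2-\tfrac14\Big)\frac1{x^2}+Q(x).$$ For $k\in\mathbb{C}$ let $\mathcal{N}(L_{m^2}+k^2)$ be the space of all $g\in AC^1]0,\infty[$ (that is, $g:]0,\infty[\to\mathbb{C}$ is differentiable and $g'$ is locally absolutely continuous) with $L_{m^2}g=-k^2g$ almost everywhere on $]0,\infty[$. Put $$u_m^0(x,k)=x^{\frac12+m}\sum_{n=0}^\infty\frac{1}{n!\,\Gamma(m+n+1)}\Big(\frac{k^2x^2}{4}\Big)^n ,$$ which for $\Re(k)\ge 0$, $k\neq0$, equals $(2/k)^m\sqrt{x}\,I_m(kx)$ with $I_m$ the modified Bessel function. Let $\Re(k)\ge0$. (i) Let $\Re(m)\ge0$, $m\ne0$, and suppose that $\int_0^1x|Q(x)|\,dx<\infty$. Then every $g\in\mathcal{N}(L_{m^2}+k^2)$ satisfies $$g(x)=\mathcal{O}(x^{\frac12-\Re(m)}),\qquad \partial_xg(x)=\mathcal{O}(x^{-\frac12-\Re(m)}),\qquad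 x\to0.$$ Moreover, if $\Re(m)>0$, there is a unique $u_m(\cdot,k)\in\mathcal{N}(L_{m^2}+k^2)$ such that $$u_m(x,k)-u_m^0(x,k)=o(x^{\frac12+\Re(m)}),\qquad \partial_xu_m(x,k)-\partial_xu_m^0(x,k)=o(x^{-\frac12+\Re(m)}),\qquad x\to0,$$ and for every $g\in\mathcal{N}(L_{m^2}+k^2)$ that is linearly independent of $u_m(\cdot,k)$ the limit $$\lim_{x\to0}\frac{g(x)}{x^{\frac12-m}}$$ exists and does not vanish. (ii) Let $m=0$ and suppose that $\int_0^1x\,(1+|\ln(x)|)\,|Q(x)|\,dx<\infty$. Then every $g\in\mathcal{N}(L_0+k^2)$ satisfies $$g(x)=\mathcal{O}(x^{\frac12}\ln(x)),\qquad \partial_xg(x)=\mathcal{O}(x^{-\frac12}\ln(x)),\qquad x\to0.$$ Moreover, there is a unique $u_0(\cdot,k)\in\mathcal{N}(L_0+k^2)$ such that $$u_0(x,k)-u_0^0(x,k)=o(x^{\frac12}),\qquad \partial_xu_0(x,k)-\partial_xu_0^0(x,k)=o(x^{-\frac12}),\qquad x\to0,$$ and for every $g\in\mathcal{N}(L_0+k^2)$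 that is linearly independent of $u_0(\cdot,k)$ the limit $$\lim_{x\to0}\frac{g(x)}{x^{\frac12}\ln(x)}$$ exists and does not vanish. -/

import Mathlib

open Set Filter Topology MeasureTheory Asymptotics

namespace PerturbedBessel

/-- Locally absolutely continuous functions on `]0,∞[`: absolutely continuous on every compact
subinterval. Only the values of `f` on `]0,∞[` matter. -/
def IsAC (f : ℝ → ℂ) : Prop :=
  ∀ a b : ℝ, 0 < a → 0 < b → AbsolutelyContinuousOnInterval f a b

/-- The space `AC¹]0,∞[`: differentiable functions whose derivative is locally absolutely
continuous on `]0,∞[`. -/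
def IsAC1 (f : ℝ → ℂ) : Prop :=
  DifferentiableOn ℝ f (Ioi 0) ∧ IsAC (deriv f)

/-- The potential class `∫₀¹ x |Q(x)| dx < ∞`, `Q ∈ L¹_loc]0,∞[`. -/
def InL0 (Q : ℝ → ℂ) : Prop :=
  LocallyIntegrableOn Q (Ioi 0) ∧ IntegrableOn (fun x : ℝ => x * ‖Q x‖) (Ioo 0 1)

/-- The potential class `∫₀¹ x (1 + |ln x|) |Q(x)| dx < ∞`, `Q ∈ L¹_loc]0,∞[`. -/
def InL0Log (Q : ℝ → ℂ) : Prop :=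
  LocallyIntegrableOn Q (Ioi 0) ∧
    IntegrableOn (fun x : ℝ => x * (1 + |Real.log x|) * ‖Q x‖) (Ioo 0 1)

/-- The differential expression `L_{m²} f = -f'' + (m² - 1/4) x⁻² f + Q f`. -/
noncomputable def besselOp (Q : ℝ → ℂ) (m : ℂ) (f : ℝ → ℂ) (x : ℝ) : ℂ :=
  -deriv (deriv f) x + (m ^ 2 - 1 / 4) * (1 / (x : ℂ) ^ 2) * f x + Q x * f x

/-- Membership in the null space of `L_{m²} + k²`: functions in `AC¹]0,∞[` that satisfy
`L_{m²} g = -k² g` almost everywhere on `]0,∞[`. -/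
def IsEigensolution (Q : ℝ → ℂ) (m k : ℂ) (g : ℝ → ℂ) : Prop :=
  IsAC1 g ∧ ∀ᵐ x ∂(volume.restrict (Ioi (0 : ℝ))), besselOp Q m g x = -k ^ 2 * g x

/-- The unperturbed principal solution `u_m⁰(x,k) = x^{1/2+m} 𝐅_m(k²x²/4)`, where
`𝐅_m(w) = ∑ₙ wⁿ / (n! Γ(m+n+1))`; it equals `(2/k)^m √x I_m(kx)` if `k ≠ 0`. -/
noncomputable def u0 (m k : ℂ) (x : ℝ) : ℂ :=
  (x : ℂ) ^ (1 / 2 + m) * Complex.regularizedHGFun 0 {m + 1} (k ^ 2 * (x : ℂ) ^ 2 / 4)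

/-- The defining property of the perturbed principal solution `u_m(·,k)` for `Re m ≥ 0`: an
eigensolution with `u - u_m⁰ = o(x^{1/2+Re m})` and `u' - (u_m⁰)' = o(x^{-1/2+Re m})` at `0`. -/
def IsPrincipal (Q : ℝ → ℂ) (m k : ℂ) (u : ℝ → ℂ) : Prop :=
  IsEigensolution Q m k u ∧
    (fun x => u x - u0 m k x) =o[𝓝[>] 0] (fun x : ℝ => x ^ (1 / 2 + m.re)) ∧
    (fun x => deriv u x - deriv (u0 m k) x) =o[𝓝[>] 0] (fun x : ℝ => x ^ (-1 / 2 + m.re))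

/-- Linear independence of two functions on `]0,∞[`. -/
def IndependentOnHalfLine (g u : ℝ → ℂ) : Prop :=
  LinearIndependent ℂ ![(Ioi (0 : ℝ)).domRestrict g, (Ioi (0 : ℝ)).domRestrict u]

end PerturbedBessel

/-!
Absorb `k²` into the potential, `V = Q + k²`. Writing `u = x^{1/2+m} w`, the equation for `u`
becomes `(x^{1+2m} w')' = x^{1+2m} V w`, so `u` is the principal solution as soon as
`w(x) = c + ∫₀ˣ y^{-1-2m} ∫₀ʸ s^{1+2m} V(s) w(s) ds dy` with `c = 1 / Γ(m+1)`; the condition on `Q`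
is what makes the kernel integrable, and a weighted sup norm makes the right-hand side a
contraction. Two solutions with such a leading coefficient have Wronskian zero, hence uniqueness.

If `u` is principal and `g` is any solution, `(g/u)' = -W/u²` with `W` the constant Wronskian of `g`
and `u`. L'Hôpital's rule for complex-valued functions against `x^{-2m}`, or against `ln x` when
`m = 0`, then gives the behaviour of `g`. This says nothing when `Re m = 0`, `m ≠ 0`, since
`|x^{-2m}|` is then bounded; instead the Wronskians of `g` with `x^{1/2±m}` are controlled by a
Grönwall argument, which gives the `O`-bounds for all `m ≠ 0`.
-/

namespace PerturbedBessel

section AbsoluteContinuity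

variable {E : Type*} [NormedAddCommGroup E] [NormedSpace ℝ E] {a b : ℝ}

theorem absolutelyContinuousOnInterval_of_dist_le {X Y : Type*} [PseudoMetricSpace X]
    [PseudoMetricSpace Y] {f : ℝ → X} {g : ℝ → Y} (hg : AbsolutelyContinuousOnInterval g a b)
    (h : ∀ x ∈ uIcc a b, ∀ y ∈ uIcc a b, dist (f x) (f y) ≤ dist (g x) (g y)) :
    AbsolutelyContinuousOnInterval f a b := by
  rw [absolutelyContinuousOnInterval_iff] at hg ⊢
  intro ε hε
  obtain ⟨δ, hδ, H⟩ := hg ε hε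
  refine ⟨δ, hδ, fun I hI hs => lt_of_le_of_lt (Finset.sum_le_sum fun i hi => ?_) (H I hI hs)⟩
  exact h _ (hI.1 i hi).1 _ (hI.1 i hi).2

theorem absolutelyContinuousOnInterval_intervalIntegral {f : ℝ → E}
    (hf : IntervalIntegrable f volume a b) :
    AbsolutelyContinuousOnInterval (fun x => ∫ t in a..x, f t) a b := by
  refine absolutelyContinuousOnInterval_of_dist_le
    (hf.norm.absolutelyContinuousOnInterval_intervalIntegral left_mem_uIcc) fun x hx y hy => ?_
  have hint : ∀ z ∈ uIcc a b, IntervalIntegrable f volume a z := fun z hz =>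
    hf.mono_set (uIcc_subset_uIcc left_mem_uIcc hz)
  rw [dist_eq_norm, dist_eq_norm,
    intervalIntegral.integral_interval_sub_left (hint x hx) (hint y hy),
    intervalIntegral.integral_interval_sub_left (hint x hx).norm (hint y hy).norm]
  exact intervalIntegral.norm_integral_le_abs_integral_norm

theorem integral_eq_sub_of_ae_hasDerivAt [CompleteSpace E] {f f' : ℝ → E}
    (hf : AbsolutelyContinuousOnInterval f a b)
    (hd : ∀ᵐ x : ℝ, x ∈ uIcc a b → HasDerivAt f (f' x) x)
    (hi : IntervalIntegrable f' volume a b) : ∫ x in a..b, f' x = f b - f a := by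
  obtain ⟨C, hC⟩ := (hf.sub (absolutelyContinuousOnInterval_intervalIntegral hi)
    ).const_of_ae_hasDerivAt_zero (by
      filter_upwards [hd, hi.ae_hasDerivAt_integral] with x hf hint hx
      simpa using (hf hx).sub (hint hx a left_mem_uIcc))
  have ha := hC a left_mem_uIcc
  have hb := hC b right_mem_uIcc
  simp only [Pi.sub_apply, intervalIntegral.integral_same, sub_zero] at ha hb
  rw [ha, ← hb, sub_sub_cancel]

theorem ae_differentiableAt_of_absolutelyContinuousOnInterval {f : ℝ → ℂ}
    (hf : AbsolutelyContinuousOnInterval f a b) :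
    ∀ᵐ x : ℝ, x ∈ uIcc a b → DifferentiableAt ℝ f x := by
  have hre : AbsolutelyContinuousOnInterval (fun x => (f x).re) a b :=
    absolutelyContinuousOnInterval_of_dist_le hf fun x _ y _ => by
      simpa [Complex.dist_eq, Real.dist_eq] using Complex.abs_re_le_norm (f x - f y)
  have him : AbsolutelyContinuousOnInterval (fun x => (f x).im) a b :=
    absolutelyContinuousOnInterval_of_dist_le hf fun x _ y _ => by
      simpa [Complex.dist_eq, Real.dist_eq] using Complex.abs_im_le_norm (f x - f y)
  filter_upwards [hre.ae_differentiableAt, him.ae_differentiableAt] with x hre him hx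
  exact ((hre hx).hasDerivAt.ofReal_comp.add
    ((him hx).hasDerivAt.ofReal_comp.mul_const Complex.I)).differentiableAt.congr_of_eventuallyEq
      (.of_forall fun y => (Complex.re_add_im (f y)).symm)

theorem uIcc_subset_Ioi {a b c : ℝ} (ha : c < a) (hb : c < b) : uIcc a b ⊆ Ioi c :=
  fun _ hx => lt_of_lt_of_le (lt_min ha hb) hx.1

variable {f g f' : ℝ → ℂ}

theorem IsAC.continuousOn (hf : IsAC f) : ContinuousOn f (Ioi 0) := by
  intro x (hx : 0 < x)
  have h := (hf (x / 2) (2 * x) (by positivity) (by positivity)).continuousOn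
  rw [uIcc_of_le (by linarith)] at h
  exact (h.continuousAt (Icc_mem_nhds (by linarith) (by linarith))).continuousWithinAt

theorem IsAC.congr (hf : IsAC f) (h : EqOn f g (Ioi 0)) : IsAC g := fun a b ha hb =>
  absolutelyContinuousOnInterval_of_dist_le (hf a b ha hb) fun x hx y hy => by
    rw [h (uIcc_subset_Ioi ha hb hx), h (uIcc_subset_Ioi ha hb hy)]

theorem IsAC.add (hf : IsAC f) (hg : IsAC g) : IsAC (fun x => f x + g x) :=
  fun a b ha hb => (hf a b ha hb).add (hg a b ha hb)

theorem IsAC.sub (hf : IsAC f) (hg : IsAC g) : IsAC (fun x => f x - g x) :=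
  fun a b ha hb => (hf a b ha hb).sub (hg a b ha hb)

theorem IsAC.mul (hf : IsAC f) (hg : IsAC g) : IsAC (fun x => f x * g x) :=
  fun a b ha hb => (hf a b ha hb).smul (hg a b ha hb)

theorem IsAC.const_mul (c : ℂ) (hf : IsAC f) : IsAC (fun x => c * f x) :=
  fun a b ha hb => (hf a b ha hb).const_smul c

theorem isAC_of_hasDerivAt (hd : ∀ x, 0 < x → HasDerivAt f (f' x) x)
    (hc : ContinuousOn f' (Ioi 0)) : IsAC f := fun a b ha hb => by
  have hcd : ContDiffOn ℝ 1 f (Ioi 0) := by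
    rw [contDiffOn_one_iff_derivWithin (uniqueDiffOn_Ioi 0)]
    exact ⟨fun x hx => (hd x hx).differentiableAt.differentiableWithinAt, hc.congr fun x hx =>
      (hd x hx).hasDerivWithinAt.derivWithin (uniqueDiffOn_Ioi 0 x hx)⟩
  exact (hcd.mono (uIcc_subset_Ioi ha hb)).absolutelyContinuousOnInterval

theorem IsAC.integral_eq_sub (hf : IsAC f) (hd : ∀ᵐ x : ℝ, 0 < x → HasDerivAt f (f' x) x)
    (hf' : LocallyIntegrableOn f' (Ioi 0)) (ha : 0 < a) (hb : 0 < b) :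
    ∫ x in a..b, f' x = f b - f a := by
  refine integral_eq_sub_of_ae_hasDerivAt (hf a b ha hb) ?_
    (hf'.integrableOn_compact_subset (uIcc_subset_Ioi ha hb) isCompact_uIcc).intervalIntegrable
  filter_upwards [hd] with x h hx using h (uIcc_subset_Ioi ha hb hx)

theorem IsAC.ae_differentiableAt (hf : IsAC f) :
    ∀ᵐ x : ℝ, 0 < x → DifferentiableAt ℝ f x := by
  refine (ae_restrict_iff' measurableSet_Ioi).1
    (ae_restrict_of_ae_restrict_inter_Ioo fun a b ha hb _ => ?_)
  rw [ae_restrict_iff' (measurableSet_Ioi.inter measurableSet_Ioo)]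
  filter_upwards [ae_differentiableAt_of_absolutelyContinuousOnInterval (hf a b ha hb)]
    with x h hx using h (Icc_subset_uIcc (Ioo_subset_Icc_self hx.2))

theorem IsAC1.hasDerivAt (hf : IsAC1 f) {x : ℝ} (hx : 0 < x) : HasDerivAt f (deriv f x) x :=
  (hf.1.differentiableAt (Ioi_mem_nhds hx)).hasDerivAt

theorem IsAC1.isAC (hf : IsAC1 f) : IsAC f :=
  isAC_of_hasDerivAt (fun _ hx => hf.hasDerivAt hx) hf.2.continuousOn

end AbsoluteContinuity

section SecondOrderEquation

/-- Solutions on `]0,∞[` of the second-order linear equation `g'' = P g` in the sense of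
Carathéodory: `g` is of class `AC¹` and satisfies the equation almost everywhere. -/
def IsSolution (P g : ℝ → ℂ) : Prop :=
  IsAC1 g ∧ ∀ᵐ x : ℝ, 0 < x → deriv (deriv g) x = P x * g x

/-- The Wronskian `W(g, u) = g u' - g' u`. -/
noncomputable def wronskian (g u : ℝ → ℂ) (x : ℝ) : ℂ :=
  g x * deriv u x - deriv g x * u x

variable {P P₁ P₂ f g u : ℝ → ℂ} {a b x : ℝ}

theorem IsSolution.hasDerivAt (hg : IsSolution P g) (hx : 0 < x) : HasDerivAt g (deriv g x) x :=
  hg.1.hasDerivAt hx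

theorem IsSolution.continuousOn (hg : IsSolution P g) : ContinuousOn g (Ioi 0) :=
  hg.1.isAC.continuousOn

theorem IsSolution.continuousOn_deriv (hg : IsSolution P g) : ContinuousOn (deriv g) (Ioi 0) :=
  hg.1.2.continuousOn

theorem IsSolution.ae_hasDerivAt_deriv (hg : IsSolution P g) :
    ∀ᵐ x : ℝ, 0 < x → HasDerivAt (deriv g) (P x * g x) x := by
  filter_upwards [hg.1.2.ae_differentiableAt, hg.2] with x hd heq hx
  exact (hd hx).hasDerivAt.congr_deriv (heq hx)

theorem isSolution_of_hasDerivAt {g' : ℝ → ℂ} (hg : ∀ x, 0 < x → HasDerivAt g (g' x) x)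
    (hac : IsAC g') (hg' : ∀ᵐ x : ℝ, 0 < x → HasDerivAt g' (P x * g x) x) : IsSolution P g := by
  have heq : EqOn g' (deriv g) (Ioi 0) := fun x hx => (hg x hx).deriv.symm
  refine ⟨⟨fun x hx => (hg x hx).differentiableAt.differentiableWithinAt, hac.congr heq⟩, ?_⟩
  filter_upwards [hg'] with x h hx
  exact ((h hx).congr_of_eventuallyEq
    (heq.symm.eventuallyEq_of_mem (Ioi_mem_nhds hx))).deriv

theorem IsSolution.sub_const_mul (hg : IsSolution P g) (hu : IsSolution P u) (c : ℂ) :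
    IsSolution P (fun x => g x - c * u x) := by
  refine isSolution_of_hasDerivAt (g' := fun x => deriv g x - c * deriv u x)
    (fun x hx => (hg.hasDerivAt hx).sub ((hu.hasDerivAt hx).const_mul c))
    (hg.1.2.sub (hu.1.2.const_mul c)) ?_
  filter_upwards [hg.ae_hasDerivAt_deriv, hu.ae_hasDerivAt_deriv] with x hg' hu' hx
  exact ((hg' hx).sub ((hu' hx).const_mul c)).congr_deriv (by ring)

theorem IsSolution.integral_deriv_eq_sub (hg : IsSolution P g) (ha : 0 < a) (hb : 0 < b) :
    ∫ x in a..b, deriv g x = g b - g a :=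
  hg.1.isAC.integral_eq_sub (.of_forall fun _ hx => hg.hasDerivAt hx)
    (hg.continuousOn_deriv.locallyIntegrableOn measurableSet_Ioi) ha hb

theorem IsSolution.integral_mul_eq_sub (hg : IsSolution P g)
    (hP : LocallyIntegrableOn P (Ioi 0)) (ha : 0 < a) (hb : 0 < b) :
    ∫ x in a..b, P x * g x = deriv g b - deriv g a :=
  hg.1.2.integral_eq_sub hg.ae_hasDerivAt_deriv
    (hP.mul_continuousOn hg.continuousOn isOpen_Ioi.isLocallyClosed) ha hb

/-! ### Wronskians -/

theorem wronskian_mul_sub_mul (g f₁ f₂ : ℝ → ℂ) (x : ℝ) :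
    wronskian f₁ g x * f₂ x - wronskian f₂ g x * f₁ x = wronskian f₁ f₂ x * g x := by
  simp only [wronskian]; ring

theorem wronskian_mul_deriv_sub_mul_deriv (g f₁ f₂ : ℝ → ℂ) (x : ℝ) :
    wronskian f₁ g x * deriv f₂ x - wronskian f₂ g x * deriv f₁ x =
      wronskian f₁ f₂ x * deriv g x := by
  simp only [wronskian]; ring

theorem IsSolution.lagrange_identity (hf : IsSolution P₁ f) (hg : IsSolution P₂ g)
    (hP : LocallyIntegrableOn (fun x => P₂ x - P₁ x) (Ioi 0)) (ha : 0 < a) (hb : 0 < b) :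
    ∫ x in a..b, (P₂ x - P₁ x) * (f x * g x) = wronskian f g b - wronskian f g a := by
  have hac : IsAC (wronskian f g) := (hf.1.isAC.mul hg.1.2).sub (hf.1.2.mul hg.1.isAC)
  refine hac.integral_eq_sub ?_ (hP.mul_continuousOn (hf.continuousOn.mul hg.continuousOn)
    isOpen_Ioi.isLocallyClosed) ha hb
  filter_upwards [hf.ae_hasDerivAt_deriv, hg.ae_hasDerivAt_deriv] with x hf' hg' hx
  exact (((hf.hasDerivAt hx).mul (hg' hx)).sub ((hf' hx).mul (hg.hasDerivAt hx))).congr_deriv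
    (by ring)

theorem IsSolution.wronskian_eq (hf : IsSolution P f) (hg : IsSolution P g) (ha : 0 < a)
    (hb : 0 < b) : wronskian f g a = wronskian f g b := by
  have h := hf.lagrange_identity hg (by simpa using locallyIntegrableOn_zero) ha hb
  simp only [sub_self, zero_mul, intervalIntegral.integral_zero] at h
  exact (sub_eq_zero.1 h.symm).symm

theorem IsSolution.hasDerivAt_div (hg : IsSolution P g) (hu : IsSolution P u) (hx : 0 < x)
    (h0 : u x ≠ 0) : HasDerivAt (fun y => g y / u y) (-wronskian g u x / u x ^ 2) x :=
  ((hg.hasDerivAt hx).div (hu.hasDerivAt hx) h0).congr_deriv (by rw [wronskian]; ring)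

/-! ### The Cauchy problem -/

theorem le_two_mul_of_le_add_abs_integral {h κ : ℝ → ℝ} (hh : ContinuousOn h (uIcc a b))
    (hh0 : ∀ y ∈ uIcc a b, 0 ≤ h y) (hκ : IntervalIntegrable κ volume a b)
    (hκ0 : ∀ y ∈ uIcc a b, 0 ≤ κ y) (hsmall : |∫ y in a..b, κ y| ≤ 1 / 2)
    (hle : ∀ y ∈ uIcc a b, h y ≤ h a + |∫ s in a..y, κ s * h s|) : h b ≤ 2 * h a := by
  obtain ⟨z, hz, hmax⟩ := isCompact_uIcc.exists_isMaxOn nonempty_uIcc hh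
  have hsub : uIoc a z ⊆ uIoc a b := uIoc_subset_uIoc_of_uIcc_subset_uIcc
    (uIcc_subset_uIcc left_mem_uIcc hz)
  have hκz : |∫ s in a..z, κ s| ≤ 1 / 2 :=
    (intervalIntegral.abs_integral_mono_interval hsub
      (ae_restrict_of_forall_mem measurableSet_uIoc fun s hs => hκ0 s (uIoc_subset_uIcc hs))
      hκ).trans hsmall
  have hint : |∫ s in a..z, κ s * h s| ≤ |∫ s in a..z, κ s * h z| := by
    rw [← Real.norm_eq_abs]
    refine intervalIntegral.norm_integral_le_abs_of_norm_le
      (ae_restrict_of_forall_mem measurableSet_uIoc fun s hs => ?_)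
      ((hκ.mono_set (uIcc_subset_uIcc left_mem_uIcc hz)).mul_const _)
    have hs := uIoc_subset_uIcc (hsub hs)
    rw [Real.norm_of_nonneg (mul_nonneg (hκ0 s hs) (hh0 s hs))]
    exact mul_le_mul_of_nonneg_left (hmax hs) (hκ0 s hs)
  rw [intervalIntegral.integral_mul_const, abs_mul, abs_of_nonneg (hh0 z hz)] at hint
  have hb : h b ≤ h z := hmax right_mem_uIcc
  nlinarith [hle z hz, hh0 z hz]

theorem IsSolution.max_norm_le (hg : IsSolution P g) (hP : LocallyIntegrableOn P (Ioi 0))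
    (ha : 0 < a) (hb : 0 < b) :
    max ‖g b‖ ‖deriv g b‖ ≤ max ‖g a‖ ‖deriv g a‖ +
      |∫ x in a..b, (1 + ‖P x‖) * max ‖g x‖ ‖deriv g x‖| := by
  have hint : IntervalIntegrable (fun x => (1 + ‖P x‖) * max ‖g x‖ ‖deriv g x‖) volume a b := by
    have hsub := uIcc_subset_Ioi ha hb
    have hPab := (hP.integrableOn_compact_subset hsub isCompact_uIcc).intervalIntegrable
    exact (intervalIntegrable_const.add hPab.norm).mul_continuousOn
      ((hg.continuousOn.norm.sup hg.continuousOn_deriv.norm).mono hsub)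
  have bound : ∀ {v v' : ℝ → ℂ}, ∫ x in a..b, v' x = v b - v a →
      (∀ x, ‖v' x‖ ≤ (1 + ‖P x‖) * max ‖g x‖ ‖deriv g x‖) →
      ‖v b‖ ≤ ‖v a‖ + |∫ x in a..b, (1 + ‖P x‖) * max ‖g x‖ ‖deriv g x‖| := by
    intro v v' hv hle
    calc ‖v b‖ ≤ ‖v a‖ + ‖v b - v a‖ := norm_le_norm_add_norm_sub' _ _
      _ ≤ _ := by
        rw [← hv]
        gcongr
        exact intervalIntegral.norm_integral_le_abs_of_norm_le (.of_forall hle) hint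
  refine max_le ((bound (hg.integral_deriv_eq_sub ha hb) fun x => ?_).trans ?_)
    ((bound (hg.integral_mul_eq_sub hP ha hb) fun x => ?_).trans ?_)
  · nlinarith [le_max_right ‖g x‖ ‖deriv g x‖, norm_nonneg (P x), norm_nonneg (deriv g x)]
  · gcongr; exact le_max_left _ _
  · rw [norm_mul]
    nlinarith [le_max_left ‖g x‖ ‖deriv g x‖, norm_nonneg (P x), norm_nonneg (g x)]
  · gcongr; exact le_max_right _ _

theorem eventually_abs_integral_le_half {κ : ℝ → ℝ} (hκ : LocallyIntegrableOn κ (Ioi 0))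
    (ha : 0 < a) : ∀ᶠ b in 𝓝 a, |∫ x in a..b, κ x| ≤ 1 / 2 := by
  have hcont : ContinuousAt (fun b => ∫ x in a..b, κ x) a := by
    have hIcc : uIcc (a / 2) (2 * a) ∈ 𝓝 a := by
      rw [uIcc_of_le (by linarith)]
      exact Icc_mem_nhds (by linarith) (by linarith)
    refine ContinuousOn.continuousAt
      (intervalIntegral.continuousOn_primitive_interval' ?_ (mem_of_mem_nhds hIcc)) hIcc
    exact (hκ.integrableOn_compact_subset (uIcc_subset_Ioi (by linarith) (by linarith))
      isCompact_uIcc).intervalIntegrable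
  have hlim := hcont.abs.tendsto
  simp only [intervalIntegral.integral_same, abs_zero] at hlim
  exact hlim.eventually_le_const one_half_pos

theorem IsSolution.eventually_eq_zero (hg : IsSolution P g) (hP : LocallyIntegrableOn P (Ioi 0))
    (ha : 0 < a) (h0 : g a = 0) (h1 : deriv g a = 0) :
    ∀ᶠ b in 𝓝 a, g b = 0 ∧ deriv g b = 0 := by
  have hκ : LocallyIntegrableOn (fun x => 1 + ‖P x‖) (Ioi 0) :=
    (locallyIntegrable_const (1 : ℝ)).locallyIntegrableOn _ |>.add hP.norm
  filter_upwards [eventually_abs_integral_le_half hκ ha, Ioi_mem_nhds ha] with b hsmall hb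
  have hsub := uIcc_subset_Ioi ha hb
  have hle := le_two_mul_of_le_add_abs_integral
    ((hg.continuousOn.norm.sup hg.continuousOn_deriv.norm).mono hsub)
    (fun y _ => le_max_of_le_left (norm_nonneg (g y)))
    (hκ.integrableOn_compact_subset hsub isCompact_uIcc).intervalIntegrable
    (fun y _ => by positivity) hsmall fun y hy => hg.max_norm_le hP ha (hsub hy)
  rw [h0, h1, norm_zero, max_self, mul_zero, max_le_iff] at hle
  exact ⟨norm_le_zero_iff.1 hle.1, norm_le_zero_iff.1 hle.2⟩

theorem IsSolution.eqOn_zero (hg : IsSolution P g) (hP : LocallyIntegrableOn P (Ioi 0))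
    (ha : 0 < a) (h0 : g a = 0) (h1 : deriv g a = 0) : EqOn g 0 (Ioi 0) := by
  let Z : Set ℝ := {x | 0 < x ∧ g x = 0 ∧ deriv g x = 0}
  have hopen : IsOpen Z := isOpen_iff_eventually.2 fun x hx =>
    (Filter.Eventually.and (Ioi_mem_nhds hx.1) (hg.eventually_eq_zero hP hx.1 hx.2.1 hx.2.2))
  have hclosed : closure Z ∩ Ioi 0 ⊆ Z := fun x ⟨hxZ, hx⟩ => by
    have hzero : ∀ {v : ℝ → ℂ}, ContinuousOn v (Ioi 0) → (∀ y ∈ Z, v y = 0) → v x = 0 := by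
      intro v hv hvZ
      have : (𝓝[Z] x).NeBot := mem_closure_iff_nhdsWithin_neBot.1 hxZ
      exact tendsto_nhds_unique ((hv.continuousAt (Ioi_mem_nhds hx)).mono_left nhdsWithin_le_nhds)
        (tendsto_const_nhds.congr' (eventually_nhdsWithin_of_forall fun y hy => (hvZ y hy).symm))
    exact ⟨hx, hzero hg.continuousOn fun y hy => hy.2.1,
      hzero hg.continuousOn_deriv fun y hy => hy.2.2⟩
  exact fun x hx => (isPreconnected_Ioi.subset_of_closure_inter_subset hopen
    ⟨a, ha, ha, h0, h1⟩ hclosed hx).2.1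

theorem IsSolution.eqOn_div_mul (hg : IsSolution P g) (hu : IsSolution P u)
    (hP : LocallyIntegrableOn P (Ioi 0)) (ha : 0 < a) (h0 : u a ≠ 0) (hW : wronskian g u a = 0) :
    EqOn g (fun x => g a / u a * u x) (Ioi 0) := by
  have h := (hg.sub_const_mul hu (g a / u a)).eqOn_zero hP ha (by field_simp; ring) ?_
  · exact fun x hx => sub_eq_zero.1 (h hx)
  refine ((hg.hasDerivAt ha).sub ((hu.hasDerivAt ha).const_mul _)).deriv.trans ?_
  rw [wronskian] at hW
  field_simp
  linear_combination -hW

theorem IndependentOnHalfLine.wronskian_ne_zero (hgu : IndependentOnHalfLine g u)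
    (hg : IsSolution P g) (hu : IsSolution P u) (hP : LocallyIntegrableOn P (Ioi 0))
    (ha : 0 < a) : wronskian g u a ≠ 0 := by
  intro hW
  rw [IndependentOnHalfLine, LinearIndependent.pair_iff] at hgu
  by_cases hu0 : EqOn u 0 (Ioi 0)
  · have h := hgu 0 1 (funext fun x => by simp [domRestrict, hu0 x.2])
    exact one_ne_zero h.2
  · obtain ⟨b, hb : 0 < b, hub⟩ : ∃ b ∈ Ioi (0 : ℝ), u b ≠ 0 := by
      simpa [EqOn] using hu0
    have heq := hg.eqOn_div_mul hu hP hb hub ((hg.wronskian_eq hu hb ha).trans hW)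
    have h := hgu 1 (-(g b / u b)) (funext fun x => by simp [domRestrict, heq x.2])
    exact one_ne_zero h.1

end SecondOrderEquation

section LHopital

variable {E : Type*} [NormedAddCommGroup E] [NormedSpace ℝ E] {f f' : ℝ → E} {ρ ρ' : ℝ → ℝ}
  {a : ℝ}

theorem norm_sub_le_sub_of_norm_deriv_le {x y : ℝ} (hxy : x ≤ y)
    (hf : ∀ t ∈ Icc x y, HasDerivAt f (f' t) t) (hρ : ∀ t ∈ Icc x y, HasDerivAt ρ (ρ' t) t)
    (hle : ∀ t ∈ Icc x y, ‖f' t‖ ≤ ρ' t) : ‖f y - f x‖ ≤ ρ y - ρ x :=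
  image_norm_le_of_norm_deriv_right_le_deriv_boundary' (f := fun t => f t - f x)
    (B := fun t => ρ t - ρ x)
    (fun t ht => ((hf t ht).sub_const _).continuousAt.continuousWithinAt)
    (fun t ht => ((hf t (Ico_subset_Icc_self ht)).sub_const _).hasDerivWithinAt) (by simp)
    (fun t ht => ((hρ t ht).sub_const _).continuousAt.continuousWithinAt)
    (fun t ht => ((hρ t (Ico_subset_Icc_self ht)).sub_const _).hasDerivWithinAt)
    (fun t ht => hle t (Ico_subset_Icc_self ht)) (right_mem_Icc.2 hxy)

theorem isLittleO_of_deriv_isLittleO (hf : ∀ᶠ x in 𝓝[>] a, HasDerivAt f (f' x) x)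
    (hρ : ∀ᶠ x in 𝓝[>] a, HasDerivAt ρ (ρ' x) x) (hρ' : ∀ᶠ x in 𝓝[>] a, ρ' x ≤ 0)
    (hlim : Tendsto ρ (𝓝[>] a) atTop) (hf' : f' =o[𝓝[>] a] ρ') : f =o[𝓝[>] a] ρ := by
  refine isLittleO_iff.2 fun ε hε => ?_
  obtain ⟨b, hab : a < b, H⟩ := mem_nhdsGT_iff_exists_Ioc_subset.1
    ((hf.and hρ).and (hρ'.and (hf'.def (half_pos hε))))
  have hconst : (fun _ => ‖f b‖ - ε / 2 * ρ b) =o[𝓝[>] a] ρ :=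
    isLittleO_const_left.2 (Or.inr (tendsto_norm_atTop_atTop.comp hlim))
  filter_upwards [Ioc_mem_nhdsGT hab, hlim.eventually_ge_atTop 0, hconst.def (half_pos hε)]
    with x hx hρ0 hC
  have hmem : ∀ t ∈ Icc x b, t ∈ Ioc a b := fun t ht => ⟨hx.1.trans_le ht.1, ht.2⟩
  have hdiff : ‖f b - f x‖ ≤ -(ε / 2) * ρ b - -(ε / 2) * ρ x := by
    refine norm_sub_le_sub_of_norm_deriv_le hx.2 (fun t ht => (H (hmem t ht)).1.1)
      (fun t ht => (H (hmem t ht)).1.2.const_mul _) fun t ht => ?_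
    obtain ⟨hneg, hle⟩ := (H (hmem t ht)).2
    rwa [Real.norm_of_nonpos hneg, mul_neg, ← neg_mul] at hle
  rw [Real.norm_of_nonneg hρ0] at hC ⊢
  linarith [norm_le_norm_add_norm_sub (f b) (f x), Real.le_norm_self (‖f b‖ - ε / 2 * ρ b)]

theorem tendsto_div_of_tendsto_deriv_div {F F' S S' : ℝ → ℂ} {α : ℂ}
    (hF : ∀ᶠ x in 𝓝[>] a, HasDerivAt F (F' x) x) (hS : ∀ᶠ x in 𝓝[>] a, HasDerivAt S (S' x) x)
    (hρ : ∀ᶠ x in 𝓝[>] a, HasDerivAt (fun x => ‖S x‖) (ρ' x) x)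
    (hρ' : ∀ᶠ x in 𝓝[>] a, ρ' x ≤ 0) (hlim : Tendsto (fun x => ‖S x‖) (𝓝[>] a) atTop)
    (hS' : S' =O[𝓝[>] a] ρ') (hS'0 : ∀ᶠ x in 𝓝[>] a, S' x ≠ 0)
    (hα : Tendsto (fun x => F' x / S' x) (𝓝[>] a) (𝓝 α)) :
    Tendsto (fun x => F x / S x) (𝓝[>] a) (𝓝 α) := by
  have hderiv : (fun x => F' x - α * S' x) =o[𝓝[>] a] S' := by
    refine (isLittleO_iff_tendsto' (hS'0.mono fun x hx h => absurd h hx)).2 ?_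
    refine (tendsto_sub_nhds_zero_iff.2 hα).congr' ?_
    filter_upwards [hS'0] with x hx
    rw [sub_div, mul_div_cancel_right₀ _ hx]
  have hlittle : (fun x => F x - α * S x) =o[𝓝[>] a] fun x => ‖S x‖ :=
    isLittleO_of_deriv_isLittleO ((hF.and hS).mono fun x h => h.1.sub (h.2.const_mul α))
      hρ hρ' hlim (hderiv.trans_isBigO hS')
  rw [← tendsto_sub_nhds_zero_iff]
  refine (isLittleO_norm_right.1 hlittle).tendsto_div_nhds_zero.congr' ?_
  filter_upwards [hlim.eventually_gt_atTop 0] with x hx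
  rw [sub_div, mul_div_cancel_right₀ _ (norm_pos_iff.1 hx)]

end LHopital

section Volterra

variable {E 𝕜 : Type*} [NormedAddCommGroup E] [NormedSpace ℝ E] [RCLike 𝕜]

theorem continuousOn_integral_Ici {f : ℝ → E}
    (hf : ∀ b, 0 ≤ b → IntervalIntegrable f volume 0 b) :
    ContinuousOn (fun x => ∫ s in (0 : ℝ)..x, f s) (Ici 0) := by
  intro x (hx : 0 ≤ x)
  have hx1 : 0 ≤ x + 1 := by linarith
  have h := intervalIntegral.continuousOn_primitive_interval' (hf (x + 1) hx1) left_mem_uIcc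
  rw [uIcc_of_le hx1] at h
  exact (h x ⟨hx, by linarith⟩).mono_of_mem_nhdsWithin
    (mem_nhdsWithin.2 ⟨Iio (x + 1), isOpen_Iio, by simp, fun y hy => ⟨hy.2, hy.1.le⟩⟩)

theorem hasDerivAt_integral_Ioi [CompleteSpace E] {f : ℝ → E}
    (hf : ∀ b, 0 ≤ b → IntervalIntegrable f volume 0 b) (hc : ContinuousOn f (Ioi 0)) {x : ℝ}
    (hx : 0 < x) : HasDerivAt (fun x => ∫ s in (0 : ℝ)..x, f s) (f x) x :=
  intervalIntegral.integral_hasDerivAt_right (hf x hx.le)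
    (hc.stronglyMeasurableAtFilter isOpen_Ioi x hx) (hc.continuousAt (Ioi_mem_nhds hx))

/-- Coefficients for which the Volterra equation `w(x) = c + ∫₀ˣ p(y) ∫₀ʸ q(s) w(s) ds dy` is
well posed up to the endpoint `0`, where `p` may be singular. -/
structure IsVolterraPair (p q : ℝ → 𝕜) : Prop where
  continuousOn : ContinuousOn p (Ioi 0)
  intervalIntegrable : ∀ b, 0 ≤ b → IntervalIntegrable q volume 0 b
  intervalIntegrable_mul : ∀ b, 0 ≤ b →
    IntervalIntegrable (fun y => ‖p y‖ * ∫ s in (0 : ℝ)..y, ‖q s‖) volume 0 b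

/-- The Volterra operator `w ↦ ∫₀ˣ p(y) ∫₀ʸ q(s) w(s) ds dy`. -/
noncomputable def volterraOp (p q w : ℝ → 𝕜) (x : ℝ) : 𝕜 :=
  ∫ y in (0 : ℝ)..x, p y * ∫ s in (0 : ℝ)..y, q s * w s

/-- The weight `exp (2 Φ(x))`, `Φ(x) = ∫₀ˣ |p(y)| ∫₀ʸ |q(s)| ds dy`, that turns the Volterra
operator into a contraction. It is extended by `1` to `x < 0`, so that the weighted space can be
modelled on the bounded continuous functions on `ℝ`. -/
noncomputable def volterraWeight (p q : ℝ → 𝕜) (x : ℝ) : ℝ :=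
  Real.exp (2 * ∫ y in (0 : ℝ)..max x 0, ‖p y‖ * ∫ s in (0 : ℝ)..y, ‖q s‖)

namespace IsVolterraPair

variable {p q w w₁ w₂ : ℝ → 𝕜} {x : ℝ}

theorem continuous_weight (h : IsVolterraPair p q) : Continuous (volterraWeight p q) :=
  Real.continuous_exp.comp (continuous_const.mul
    ((continuousOn_integral_Ici h.intervalIntegrable_mul).comp_continuous
      (continuous_id.max continuous_const) fun _ => mem_Ici.2 (le_max_right _ _)))

theorem hasDerivAt_weight (h : IsVolterraPair p q) (hx : 0 < x) :
    HasDerivAt (volterraWeight p q)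
      (volterraWeight p q x * (2 * (‖p x‖ * ∫ s in (0 : ℝ)..x, ‖q s‖))) x := by
  have hcont : ContinuousOn (fun y => ‖p y‖ * ∫ s in (0 : ℝ)..y, ‖q s‖) (Ioi 0) :=
    h.continuousOn.norm.mul ((continuousOn_integral_Ici fun b hb =>
      (h.intervalIntegrable b hb).norm).mono Ioi_subset_Ici_self)
  have hexp := ((hasDerivAt_integral_Ioi h.intervalIntegrable_mul hcont hx).const_mul 2).exp
  rw [volterraWeight, max_eq_left hx.le]
  refine hexp.congr_of_eventuallyEq ?_
  filter_upwards [Ioi_mem_nhds hx] with y hy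
  rw [volterraWeight, max_eq_left (le_of_lt hy)]

theorem weight_pos : 0 < volterraWeight p q x := Real.exp_pos _

theorem one_le_weight : 1 ≤ volterraWeight p q x :=
  Real.one_le_exp <| mul_nonneg zero_le_two <|
    intervalIntegral.integral_nonneg (le_max_right _ _) fun _ hy =>
      mul_nonneg (norm_nonneg _) (intervalIntegral.integral_nonneg hy.1 fun _ _ => norm_nonneg _)

theorem weight_zero : volterraWeight p q 0 = 1 := by simp [volterraWeight]

theorem weight_max_zero : volterraWeight p q (max x 0) = volterraWeight p q x := by
  simp [volterraWeight]

theorem monotoneOn_weight (h : IsVolterraPair p q) :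
    MonotoneOn (volterraWeight p q) (Ici 0) := by
  refine monotoneOn_of_deriv_nonneg (convex_Ici 0) h.continuous_weight.continuousOn ?_ ?_ <;>
    rw [interior_Ici] <;> intro y hy
  · exact (h.hasDerivAt_weight hy).differentiableAt.differentiableWithinAt
  · rw [(h.hasDerivAt_weight hy).deriv]
    have hint : 0 ≤ ∫ s in (0 : ℝ)..y, ‖q s‖ :=
      intervalIntegral.integral_nonneg (le_of_lt hy) fun _ _ => norm_nonneg _
    exact mul_nonneg weight_pos.le (by positivity)

theorem intervalIntegrable_mul_continuousOn (h : IsVolterraPair p q)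
    (hw : ContinuousOn w (Ici 0)) (b : ℝ) (hb : 0 ≤ b) :
    IntervalIntegrable (fun s => q s * w s) volume 0 b :=
  (h.intervalIntegrable b hb).mul_continuousOn
    (hw.mono (by rw [uIcc_of_le hb]; exact Icc_subset_Ici_self))

theorem norm_integral_mul_le (h : IsVolterraPair p q) {M y : ℝ} (hy : 0 ≤ y)
    (hM : ∀ s ∈ Icc 0 y, ‖w s‖ ≤ M) :
    ‖∫ s in (0 : ℝ)..y, q s * w s‖ ≤ M * ∫ s in (0 : ℝ)..y, ‖q s‖ := by
  rw [← intervalIntegral.integral_const_mul]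
  refine intervalIntegral.norm_integral_le_of_norm_le hy (.of_forall fun s hs => ?_)
    ((h.intervalIntegrable y hy).norm.const_mul M)
  rw [norm_mul, mul_comm]
  exact mul_le_mul_of_nonneg_right (hM s ⟨hs.1.le, hs.2⟩) (norm_nonneg _)

theorem continuousOn_integrand (h : IsVolterraPair p q) (hw : ContinuousOn w (Ici 0)) :
    ContinuousOn (fun y => p y * ∫ s in (0 : ℝ)..y, q s * w s) (Ioi 0) :=
  h.continuousOn.mul ((continuousOn_integral_Ici
    (h.intervalIntegrable_mul_continuousOn hw)).mono Ioi_subset_Ici_self)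

theorem intervalIntegrable_integrand (h : IsVolterraPair p q) (hw : ContinuousOn w (Ici 0))
    (b : ℝ) (hb : 0 ≤ b) :
    IntervalIntegrable (fun y => p y * ∫ s in (0 : ℝ)..y, q s * w s) volume 0 b := by
  obtain ⟨M, hM⟩ := isCompact_Icc.exists_bound_of_continuousOn
    (hw.mono (Icc_subset_Ici_self (b := 0) (a := b)))
  have hmaj := (h.intervalIntegrable_mul b hb).const_mul M
  rw [intervalIntegrable_iff_integrableOn_Ioc_of_le hb] at hmaj ⊢
  refine hmaj.mono' (((h.continuousOn_integrand hw).mono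
    Ioc_subset_Ioi_self).aestronglyMeasurable measurableSet_Ioc)
    (ae_restrict_of_forall_mem measurableSet_Ioc fun y hy => ?_)
  rw [norm_mul, mul_left_comm]
  exact mul_le_mul_of_nonneg_left
    (h.norm_integral_mul_le hy.1.le fun s hs => hM s ⟨hs.1, hs.2.trans hy.2⟩) (norm_nonneg _)

theorem continuousOn_op (h : IsVolterraPair p q) (hw : ContinuousOn w (Ici 0)) :
    ContinuousOn (volterraOp p q w) (Ici 0) :=
  continuousOn_integral_Ici (h.intervalIntegrable_integrand hw)

theorem hasDerivAt_op (h : IsVolterraPair p q) (hw : ContinuousOn w (Ici 0)) (hx : 0 < x) :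
    HasDerivAt (volterraOp p q w) (p x * ∫ s in (0 : ℝ)..x, q s * w s) x :=
  hasDerivAt_integral_Ioi (h.intervalIntegrable_integrand hw) (h.continuousOn_integrand hw) hx

theorem op_sub (h : IsVolterraPair p q) (hw₁ : ContinuousOn w₁ (Ici 0))
    (hw₂ : ContinuousOn w₂ (Ici 0)) (hx : 0 ≤ x) :
    volterraOp p q (fun s => w₁ s - w₂ s) x = volterraOp p q w₁ x - volterraOp p q w₂ x := by
  simp only [volterraOp]
  rw [← intervalIntegral.integral_sub (h.intervalIntegrable_integrand hw₁ x hx)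
    (h.intervalIntegrable_integrand hw₂ x hx)]
  refine intervalIntegral.integral_congr fun y hy => ?_
  rw [uIcc_of_le hx] at hy
  simp only [mul_sub]
  rw [intervalIntegral.integral_sub (h.intervalIntegrable_mul_continuousOn hw₁ y hy.1)
    (h.intervalIntegrable_mul_continuousOn hw₂ y hy.1), mul_sub]

theorem norm_op_le (h : IsVolterraPair p q) {M : ℝ} (hx : 0 ≤ x)
    (hwM : ∀ s ∈ Icc 0 x, ‖w s‖ ≤ M * volterraWeight p q s) :
    ‖volterraOp p q w x‖ ≤ M / 2 * volterraWeight p q x := by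
  have hM : 0 ≤ M := by
    simpa [weight_zero] using (norm_nonneg (w 0)).trans (hwM 0 ⟨le_rfl, hx⟩)
  set B : ℝ → ℝ := fun y => M * volterraWeight p q y * (‖p y‖ * ∫ s in (0 : ℝ)..y, ‖q s‖)
  have hB : IntervalIntegrable B volume 0 x := (h.intervalIntegrable_mul x hx).continuousOn_mul
    (continuous_const.mul h.continuous_weight).continuousOn
  have hle : ∀ y ∈ Ioc 0 x, ‖p y * ∫ s in (0 : ℝ)..y, q s * w s‖ ≤ B y := fun y hy => by
    simp only [B]
    rw [norm_mul, mul_left_comm]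
    refine mul_le_mul_of_nonneg_left (h.norm_integral_mul_le hy.1.le fun s hs => ?_)
      (norm_nonneg _)
    exact (hwM s ⟨hs.1, hs.2.trans hy.2⟩).trans
      (mul_le_mul_of_nonneg_left (h.monotoneOn_weight hs.1 hy.1.le hs.2) hM)
  calc ‖volterraOp p q w x‖ ≤ ∫ y in (0 : ℝ)..x, B y :=
        intervalIntegral.norm_integral_le_of_norm_le hx (.of_forall hle) hB
    _ = M / 2 * volterraWeight p q x - M / 2 * volterraWeight p q 0 :=
        intervalIntegral.integral_eq_sub_of_hasDerivAt_of_le hx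
          (continuous_const.mul h.continuous_weight).continuousOn
          (fun y hy => ((h.hasDerivAt_weight hy.1).const_mul (M / 2)).congr_deriv (by ring)) hB
    _ ≤ M / 2 * volterraWeight p q x := by
        rw [weight_zero]; linarith

theorem norm_op_weight_mul_le (h : IsVolterraPair p q) {M : ℝ} (hw : ∀ s, ‖w s‖ ≤ M) :
    ‖volterraOp p q (fun s => (volterraWeight p q s : 𝕜) * w s) (max x 0)‖ ≤
      M / 2 * volterraWeight p q x := by
  rw [← weight_max_zero (x := x)]
  refine h.norm_op_le (le_max_right _ _) fun s _ => ?_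
  rw [norm_mul, RCLike.norm_ofReal, abs_of_pos weight_pos, mul_comm]
  exact mul_le_mul_of_nonneg_right (hw s) weight_pos.le

theorem continuous_weight_mul (h : IsVolterraPair p q) (hw : Continuous w) :
    Continuous fun s => (volterraWeight p q s : 𝕜) * w s :=
  (RCLike.continuous_ofReal.comp h.continuous_weight).mul hw

/-- The map `f ↦ c + K f`, `K` the Volterra operator, conjugated by the weight: if `f` is a fixed
point, then `volterraWeight p q * f` solves the Volterra equation on `[0,∞[`. -/
noncomputable def picard (h : IsVolterraPair p q) (c : 𝕜) (f : BoundedContinuousFunction ℝ 𝕜) :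
    BoundedContinuousFunction ℝ 𝕜 :=
  .ofNormedAddCommGroup (fun x => ((volterraWeight p q x)⁻¹ : ℝ) *
      (c + volterraOp p q (fun s => volterraWeight p q s * f s) (max x 0)))
    ((RCLike.continuous_ofReal.comp (h.continuous_weight.inv₀ fun _ => weight_pos.ne')).mul
      (continuous_const.add ((h.continuousOn_op
        (h.continuous_weight_mul f.continuous).continuousOn).comp_continuous
          (continuous_id.max continuous_const) fun _ => mem_Ici.2 (le_max_right _ _))))
    (‖c‖ + ‖f‖ / 2) fun x => by
      have hop := h.norm_op_weight_mul_le (x := x) f.norm_coe_le_norm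
      rw [norm_mul, RCLike.norm_ofReal, abs_of_pos (inv_pos.2 weight_pos),
        inv_mul_le_iff₀ weight_pos]
      refine (norm_add_le _ _).trans ?_
      nlinarith [norm_nonneg c, one_le_weight (p := p) (q := q) (x := x)]

theorem contractingWith_picard (h : IsVolterraPair p q) (c : 𝕜) :
    ContractingWith (1 / 2) (h.picard c) := by
  refine ⟨by norm_num [← NNReal.coe_lt_coe], LipschitzWith.of_dist_le_mul fun f g => ?_⟩
  refine (BoundedContinuousFunction.dist_le (by positivity)).2 fun x => ?_
  have hop := h.norm_op_weight_mul_le (x := x) (f - g).norm_coe_le_norm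
  simp only [BoundedContinuousFunction.coe_sub, Pi.sub_apply, mul_sub] at hop
  rw [h.op_sub (h.continuous_weight_mul f.continuous).continuousOn
    (h.continuous_weight_mul g.continuous).continuousOn (le_max_right _ _)] at hop
  rw [dist_eq_norm, dist_eq_norm]
  simp only [picard, BoundedContinuousFunction.coe_ofNormedAddCommGroup]
  rw [← mul_sub, add_sub_add_left_eq_sub, norm_mul, RCLike.norm_ofReal,
    abs_of_pos (inv_pos.2 weight_pos), inv_mul_le_iff₀ weight_pos]
  refine hop.trans_eq ?_
  push_cast
  ring

theorem exists_eq_add_op (h : IsVolterraPair p q) (c : 𝕜) :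
    ∃ w : ℝ → 𝕜, ContinuousOn w (Ici 0) ∧ ∀ x, 0 ≤ x → w x = c + volterraOp p q w x := by
  have hcontr := h.contractingWith_picard c
  set f := hcontr.fixedPoint (h.picard c)
  refine ⟨fun s => volterraWeight p q s * f s,
    (h.continuous_weight_mul f.continuous).continuousOn, fun x hx => ?_⟩
  have hfix : h.picard c f x = f x := DFunLike.congr_fun hcontr.fixedPoint_isFixedPt x
  have hne : (volterraWeight p q x : 𝕜) ≠ 0 := RCLike.ofReal_ne_zero.2 weight_pos.ne'
  simp only [picard, BoundedContinuousFunction.coe_ofNormedAddCommGroup, max_eq_left hx,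
    RCLike.ofReal_inv] at hfix
  change (volterraWeight p q x : 𝕜) * f x = _
  rw [← hfix, mul_inv_cancel_left₀ hne]

end IsVolterraPair

end Volterra

section Triangle

variable {p q G : ℝ → ℝ} {a b : ℝ}

theorem integrable_indicator_mul_of_integral_norm_le (hp : ContinuousOn p (Ioc a b))
    (hG : ∀ s ∈ Ioc a b, ∫ y in s..b, ‖p y‖ ≤ G s) (hq : IntegrableOn q (Ioc a b))
    (hGq : IntegrableOn (fun s => G s * ‖q s‖) (Ioc a b)) :
    Integrable ({z : ℝ × ℝ | z.2 ≤ z.1}.indicator fun z => p z.1 * q z.2)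
      ((volume.restrict (Ioc a b)).prod (volume.restrict (Ioc a b))) := by
  set μ := volume.restrict (Ioc a b)
  set F : ℝ × ℝ → ℝ := {z | z.2 ≤ z.1}.indicator fun z => p z.1 * q z.2
  have hF : AEStronglyMeasurable F (μ.prod μ) :=
    ((hp.aestronglyMeasurable measurableSet_Ioc).comp_fst.mul hq.1.comp_snd).indicator
      (measurableSet_le measurable_snd measurable_fst)
  have hslice : ∀ s, (fun y => F (y, s)) = (Ici s).indicator fun y => p y * q s :=
    fun s => rfl
  have hinter : ∀ s ∈ Ioc a b, Ioc a b ∩ Ici s = Icc s b := fun s hs => by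
    ext y
    exact ⟨fun h => ⟨h.2, h.1.2⟩, fun h => ⟨⟨hs.1.trans_le h.1, h.2⟩, h.1⟩⟩
  refine (integrable_prod_iff' hF).2
    ⟨ae_restrict_of_forall_mem measurableSet_Ioc fun s hs => ?_, hGq.mono'
      hF.norm.prod_swap.integral_prod_right'
      (ae_restrict_of_forall_mem measurableSet_Ioc fun s hs => ?_)⟩
  · rw [hslice, integrable_indicator_iff measurableSet_Ici, IntegrableOn,
      Measure.restrict_restrict measurableSet_Ici, inter_comm, hinter s hs]
    exact ((hp.mono fun y hy => ⟨hs.1.trans_le hy.1, hy.2⟩).mul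
      continuousOn_const).integrableOn_Icc
  · have hnorm : (fun y => ‖F (y, s)‖) = (Ici s).indicator fun y => ‖p y‖ * ‖q s‖ := by
      funext y
      rw [congrFun (hslice s) y, norm_indicator_eq_indicator_norm]
      simp only [norm_mul]
    rw [Real.norm_of_nonneg (integral_nonneg fun _ => norm_nonneg _), hnorm,
      setIntegral_indicator measurableSet_Ici, hinter s hs, integral_Icc_eq_integral_Ioc,
      integral_mul_const, ← intervalIntegral.integral_of_le hs.2]
    exact mul_le_mul_of_nonneg_right (hG s hs) (norm_nonneg _)

theorem intervalIntegrable_mul_integral_of_integral_norm_le (hab : a ≤ b)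
    (hp : ContinuousOn p (Ioc a b)) (hG : ∀ s ∈ Ioc a b, ∫ y in s..b, ‖p y‖ ≤ G s)
    (hq : IntervalIntegrable q volume a b)
    (hGq : IntervalIntegrable (fun s => G s * ‖q s‖) volume a b) :
    IntervalIntegrable (fun y => p y * ∫ s in a..y, q s) volume a b := by
  rw [intervalIntegrable_iff_integrableOn_Ioc_of_le hab] at hq hGq ⊢
  refine (integrable_indicator_mul_of_integral_norm_le hp hG hq hGq).integral_prod_left.congr
    (ae_restrict_of_forall_mem measurableSet_Ioc fun y hy => ?_)
  have hinter : Ioc a b ∩ Iic y = Ioc a y := by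
    ext s
    exact ⟨fun h => ⟨h.1.1, h.2⟩, fun h => ⟨⟨h.1, h.2.trans hy.2⟩, h.2⟩⟩
  change ∫ s in Ioc a b, (Iic y).indicator (fun s => p y * q s) s = p y * ∫ s in a..y, q s
  rw [setIntegral_indicator measurableSet_Iic, hinter, integral_const_mul,
    intervalIntegral.integral_of_le hy.1.le]

end Triangle

section Potential

variable {E : Type*} [NormedAddCommGroup E] {Q V g : ℝ → ℂ} {m k : ℂ} {b : ℝ}

/-- The potential `(m² - 1/4) x⁻² + V(x)`, for which `g'' = (besselPotential m V) g` is the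
perturbed Bessel equation. The spectral parameter `k²` is absorbed into `V`. -/
noncomputable def besselPotential (m : ℂ) (V : ℝ → ℂ) (x : ℝ) : ℂ :=
  (m ^ 2 - 1 / 4) / (x : ℂ) ^ 2 + V x

theorem isEigensolution_iff :
    IsEigensolution Q m k g ↔ IsSolution (besselPotential m fun x => Q x + k ^ 2) g := by
  refine and_congr_right fun _ => ?_
  rw [ae_restrict_iff' measurableSet_Ioi]
  refine eventually_congr (.of_forall fun x => forall_congr' fun _ => ?_)
  rw [besselOp, besselPotential]
  constructor <;> intro h <;> linear_combination -h

theorem locallyIntegrableOn_besselPotential (hV : LocallyIntegrableOn V (Ioi 0)) :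
    LocallyIntegrableOn (besselPotential m V) (Ioi 0) := by
  refine LocallyIntegrableOn.add (ContinuousOn.locallyIntegrableOn ?_ measurableSet_Ioi) hV
  exact continuousOn_const.div (by fun_prop) fun x hx =>
    pow_ne_zero 2 (Complex.ofReal_ne_zero.2 (ne_of_gt hx))

theorem intervalIntegrable_of_locallyIntegrableOn_Ioi {f : ℝ → E} {a c : ℝ}
    (hf : LocallyIntegrableOn f (Ioi a)) (hac : a < c) (hfc : IntegrableOn f (Ioo a c))
    (hab : a ≤ b) : IntervalIntegrable f volume a b := by
  rw [intervalIntegrable_iff_integrableOn_Ioc_of_le hab]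
  have hIcc : IntegrableOn f (Icc c b) :=
    hf.integrableOn_compact_subset (fun x hx => hac.trans_le hx.1) isCompact_Icc
  exact (hfc.union hIcc).mono_set fun x hx => (lt_or_ge x c).imp (⟨hx.1, ·⟩) (⟨·, hx.2⟩)

theorem integrableOn_mul_norm_add_const {κ : ℝ → ℝ} {s : Set ℝ} (hκ : IntegrableOn κ s)
    (hQ : AEStronglyMeasurable Q (volume.restrict s))
    (hκQ : IntegrableOn (fun x => κ x * ‖Q x‖) s) (c : ℂ) :
    IntegrableOn (fun x => κ x * ‖Q x + c‖) s := by
  refine (hκQ.norm.add (hκ.norm.mul_const ‖c‖)).mono'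
    (hκ.aestronglyMeasurable.mul (hQ.add aestronglyMeasurable_const).norm) (.of_forall fun x => ?_)
  simp only [Pi.add_apply, norm_mul, norm_norm, ← mul_add]
  exact mul_le_mul_of_nonneg_left (norm_add_le _ _) (norm_nonneg _)

theorem locallyIntegrableOn_add_const (hQ : LocallyIntegrableOn Q (Ioi 0)) (c : ℂ) :
    LocallyIntegrableOn (fun x => Q x + c) (Ioi 0) :=
  hQ.add ((locallyIntegrable_const c).locallyIntegrableOn _)

theorem InL0.add_const (hQ : InL0 Q) (c : ℂ) : InL0 fun x => Q x + c :=
  ⟨locallyIntegrableOn_add_const hQ.1 c,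
    integrableOn_mul_norm_add_const (continuous_id.integrableOn_Icc.mono_set Ioo_subset_Icc_self)
      (hQ.1.aestronglyMeasurable.mono_set Ioo_subset_Ioi_self) hQ.2 c⟩

theorem InL0Log.add_const (hQ : InL0Log Q) (c : ℂ) : InL0Log fun x => Q x + c := by
  have hcont : Continuous fun x : ℝ => x + |x * Real.log x| :=
    continuous_id.add Real.continuous_mul_log.abs
  have hκ : IntegrableOn (fun x : ℝ => x * (1 + |Real.log x|)) (Ioo 0 1) :=
    (hcont.integrableOn_Icc.mono_set Ioo_subset_Icc_self).congr_fun
      (fun x hx => by simp only [abs_mul, abs_of_pos hx.1, mul_add, mul_one]) measurableSet_Ioo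
  exact ⟨locallyIntegrableOn_add_const hQ.1 c,
    integrableOn_mul_norm_add_const hκ
      (hQ.1.aestronglyMeasurable.mono_set Ioo_subset_Ioi_self) hQ.2 c⟩

theorem InL0Log.inL0 (hV : InL0Log V) : InL0 V := by
  refine ⟨hV.1, hV.2.mono' ((continuous_id.aestronglyMeasurable).mul
    (hV.1.aestronglyMeasurable.mono_set Ioo_subset_Ioi_self).norm)
    (ae_restrict_of_forall_mem measurableSet_Ioo fun x hx => ?_)⟩
  rw [norm_mul, norm_norm, Real.norm_of_nonneg hx.1.le]
  exact mul_le_mul_of_nonneg_right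
    (le_mul_of_one_le_right hx.1.le (le_add_of_nonneg_right (abs_nonneg _))) (norm_nonneg _)

theorem InL0.intervalIntegrable (hV : InL0 V) (hb : 0 ≤ b) :
    IntervalIntegrable (fun x => x * ‖V x‖) volume 0 b :=
  intervalIntegrable_of_locallyIntegrableOn_Ioi
    (hV.1.norm.continuousOn_mul continuousOn_id isOpen_Ioi.isLocallyClosed) one_pos hV.2 hb

theorem InL0.tendsto_integral (hV : InL0 V) :
    Tendsto (fun x => ∫ s in (0 : ℝ)..x, s * ‖V s‖) (𝓝[>] 0) (𝓝 0) := by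
  have h := ((continuousOn_integral_Ici fun b hb => hV.intervalIntegrable hb) 0
    self_mem_Ici).mono_left (nhdsWithin_mono _ Ioi_subset_Ici_self)
  simpa only [intervalIntegral.integral_same] using h

theorem InL0Log.intervalIntegrable (hV : InL0Log V) (hb : 0 ≤ b) :
    IntervalIntegrable (fun x => x * (1 + |Real.log x|) * ‖V x‖) volume 0 b := by
  have hcont : ContinuousOn (fun x : ℝ => x * (1 + |Real.log x|)) (Ioi 0) :=
    continuousOn_id.mul (continuousOn_const.add
      (Real.continuousOn_log.mono fun x hx => ne_of_gt hx).abs)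
  exact intervalIntegrable_of_locallyIntegrableOn_Ioi
    (hV.1.norm.continuousOn_mul hcont isOpen_Ioi.isLocallyClosed) one_pos hV.2 hb

end Potential

section ComplexPowers

variable {z : ℂ} {x : ℝ}

theorem hasDerivAt_ofReal_cpow_of_pos (hx : 0 < x) (z : ℂ) :
    HasDerivAt (fun y : ℝ => (y : ℂ) ^ z) (z * (x : ℂ) ^ (z - 1)) x := by
  rcases eq_or_ne z 0 with rfl | hz
  · simpa only [Complex.cpow_zero, zero_mul] using hasDerivAt_const x (1 : ℂ)
  · exact hasDerivAt_ofReal_cpow_const hx.ne' hz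

theorem continuousOn_ofReal_cpow (z : ℂ) : ContinuousOn (fun y : ℝ => (y : ℂ) ^ z) (Ioi 0) :=
  fun _ hx => (hasDerivAt_ofReal_cpow_of_pos hx z).continuousAt.continuousWithinAt

theorem isAC_ofReal_cpow (z : ℂ) : IsAC fun y : ℝ => (y : ℂ) ^ z :=
  isAC_of_hasDerivAt (fun _ hx => hasDerivAt_ofReal_cpow_of_pos hx z)
    (continuousOn_const.mul (continuousOn_ofReal_cpow (z - 1)))

theorem ofReal_cpow_ne_zero (hx : 0 < x) (z : ℂ) : (x : ℂ) ^ z ≠ 0 :=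
  Complex.cpow_ne_zero_iff.2 (.inl (Complex.ofReal_ne_zero.2 hx.ne'))

theorem ofReal_cpow_mul_cpow (hx : 0 < x) {a b c : ℂ} (h : a + b = c) :
    (x : ℂ) ^ a * (x : ℂ) ^ b = (x : ℂ) ^ c := by
  rw [← h, Complex.cpow_add _ _ (Complex.ofReal_ne_zero.2 hx.ne')]

theorem norm_ofReal_cpow (hx : 0 < x) {r : ℝ} (hz : z.re = r) : ‖(x : ℂ) ^ z‖ = x ^ r := by
  rw [Complex.norm_cpow_eq_rpow_re_of_pos hx, hz]

end ComplexPowers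

section PotentialPair

variable {m : ℂ} {V : ℝ → ℂ} {b x : ℝ}

theorem norm_cpow_mul_potential (hx : 0 < x) :
    ‖(x : ℂ) ^ (1 + 2 * m) * V x‖ = x ^ (2 * m.re) * (x * ‖V x‖) := by
  rw [norm_mul, norm_ofReal_cpow hx (r := 2 * m.re + 1) (by simp [add_comm]),
    Real.rpow_add_one hx.ne', mul_assoc]

theorem intervalIntegrable_cpow_mul_potential (hm : 0 ≤ m.re) (hV : InL0 V) (hb : 0 ≤ b) :
    IntervalIntegrable (fun x : ℝ => (x : ℂ) ^ (1 + 2 * m) * V x) volume 0 b := by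
  have hmeas : AEStronglyMeasurable (fun x : ℝ => (x : ℂ) ^ (1 + 2 * m) * V x)
      (volume.restrict (Ioc 0 b)) :=
    ((continuousOn_ofReal_cpow _).aestronglyMeasurable measurableSet_Ioi |>.mul
      hV.1.aestronglyMeasurable).mono_set Ioc_subset_Ioi_self
  have hint := hV.intervalIntegrable hb
  rw [intervalIntegrable_iff_integrableOn_Ioc_of_le hb] at hint ⊢
  refine (hint.const_mul (b ^ (2 * m.re))).mono' hmeas
    (ae_restrict_of_forall_mem measurableSet_Ioc fun x hx => ?_)
  rw [norm_cpow_mul_potential hx.1]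
  exact mul_le_mul_of_nonneg_right (Real.rpow_le_rpow hx.1.le hx.2 (by positivity))
    (mul_nonneg hx.1.le (norm_nonneg _))

theorem isVolterraPair_of_integral_rpow_le (hm : 0 ≤ m.re) (hV : InL0 V) {G : ℝ → ℝ → ℝ}
    (hG : ∀ b, ∀ s ∈ Ioc 0 b, ∫ y in s..b, y ^ (-1 - 2 * m.re) ≤ G b s)
    (hGV : ∀ b, 0 ≤ b →
      IntervalIntegrable (fun s => G b s * (s ^ (2 * m.re) * (s * ‖V s‖))) volume 0 b) :
    IsVolterraPair (fun x : ℝ => (x : ℂ) ^ (-1 - 2 * m))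
      fun x => (x : ℂ) ^ (1 + 2 * m) * V x where
  continuousOn := continuousOn_ofReal_cpow _
  intervalIntegrable b hb := intervalIntegrable_cpow_mul_potential hm hV hb
  intervalIntegrable_mul b hb := by
    refine intervalIntegrable_mul_integral_of_integral_norm_le hb
      ((continuousOn_ofReal_cpow _).norm.mono Ioc_subset_Ioi_self) (G := G b) (fun s hs => ?_)
      (intervalIntegrable_cpow_mul_potential hm hV hb).norm ((hGV b hb).congr fun s hs => ?_)
    · refine (intervalIntegral.integral_congr fun y hy => ?_).trans_le (hG b s hs)
      have hy0 : 0 < y := hs.1.trans_le (uIcc_of_le hs.2 ▸ hy).1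
      simp only [norm_norm]
      exact norm_ofReal_cpow hy0 (by simp)
    · rw [uIoc_of_le hb] at hs
      simp only [norm_norm]
      rw [norm_cpow_mul_potential hs.1]

theorem isVolterraPair_of_re_pos (hm : 0 < m.re) (hV : InL0 V) :
    IsVolterraPair (fun x : ℝ => (x : ℂ) ^ (-1 - 2 * m))
      fun x => (x : ℂ) ^ (1 + 2 * m) * V x := by
  refine isVolterraPair_of_integral_rpow_le hm.le hV
    (G := fun _ s => s ^ (-(2 * m.re)) / (2 * m.re)) (fun b s hs => ?_) fun b hb => ?_
  · have h0 : (0 : ℝ) ∉ uIcc s b := fun h => hs.1.not_ge (uIcc_of_le hs.2 ▸ h).1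
    rw [integral_rpow (.inr ⟨by linarith, h0⟩), show -1 - 2 * m.re + 1 = -(2 * m.re) by ring,
      ← neg_div_neg_eq, neg_neg, neg_sub]
    gcongr
    exact sub_le_self _ (Real.rpow_nonneg (hs.1.le.trans hs.2) _)
  · refine ((hV.intervalIntegrable hb).div_const (2 * m.re)).congr fun s hs => ?_
    rw [uIoc_of_le hb] at hs
    have := (Real.rpow_pos_of_pos hs.1 (2 * m.re)).ne'
    simp only [Real.rpow_neg hs.1.le]
    field_simp

theorem isVolterraPair_zero (hV : InL0Log V) :
    IsVolterraPair (fun x : ℝ => (x : ℂ) ^ (-1 - 2 * (0 : ℂ)))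
      fun x => (x : ℂ) ^ (1 + 2 * (0 : ℂ)) * V x := by
  refine isVolterraPair_of_integral_rpow_le le_rfl hV.inL0
    (G := fun b s => |Real.log b| + |Real.log s|) (fun b s hs => ?_) fun b hb => ?_
  · simp only [Complex.zero_re, mul_zero, sub_zero, Real.rpow_neg_one]
    rw [integral_inv_of_pos hs.1 (hs.1.trans_le hs.2),
      Real.log_div (hs.1.trans_le hs.2).ne' hs.1.ne']
    exact (le_abs_self _).trans (abs_sub _ _)
  · have h := ((hV.inL0.intervalIntegrable hb).const_mul (|Real.log b| - 1)).add
      (hV.intervalIntegrable hb)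
    refine h.congr fun s _ => ?_
    simp only [Complex.zero_re, mul_zero, Real.rpow_zero]
    ring

end PotentialPair

section LeadingCoefficient

variable {m c : ℂ} {V v w : ℝ → ℂ} {x : ℝ}

/-- `u` and `u'` behave at `0` like `c x^{1/2+m}` and its derivative: a form of the asymptotics of
the principal solution that does not refer to the unperturbed solution. -/
def HasLeadingCoeff (m c : ℂ) (u : ℝ → ℂ) : Prop :=
  Tendsto (fun x : ℝ => u x / (x : ℂ) ^ (1 / 2 + m)) (𝓝[>] 0) (𝓝 c) ∧
    Tendsto (fun x : ℝ => deriv u x / (x : ℂ) ^ (-1 / 2 + m)) (𝓝[>] 0) (𝓝 ((1 / 2 + m) * c))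

theorem hasDerivAt_cpow_mul (hx : 0 < x) {w' : ℂ} (hw : HasDerivAt w w' x) (m : ℂ) :
    HasDerivAt (fun x : ℝ => (x : ℂ) ^ (1 / 2 + m) * w x)
      ((x : ℂ) ^ (-1 / 2 + m) * ((1 / 2 + m) * w x + x * w')) x := by
  refine ((hasDerivAt_ofReal_cpow_of_pos hx (1 / 2 + m)).mul hw).congr_deriv ?_
  have hpow : (x : ℂ) ^ (-1 / 2 + m) * (x : ℂ) ^ (1 : ℂ) = (x : ℂ) ^ (1 / 2 + m) :=
    ofReal_cpow_mul_cpow hx (by ring)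
  rw [← hpow, Complex.cpow_one, show 1 / 2 + m - 1 = -1 / 2 + m by ring]
  ring

theorem hasLeadingCoeff_cpow_mul {w' : ℝ → ℂ} (hw : ∀ x, 0 < x → HasDerivAt w (w' x) x)
    (hc : Tendsto w (𝓝[>] 0) (𝓝 c)) (hw' : Tendsto (fun x => x * w' x) (𝓝[>] 0) (𝓝 0)) :
    HasLeadingCoeff m c fun x : ℝ => (x : ℂ) ^ (1 / 2 + m) * w x := by
  refine ⟨hc.congr' ?_, ?_⟩
  · filter_upwards [self_mem_nhdsWithin] with x hx
    rw [mul_div_cancel_left₀ _ (ofReal_cpow_ne_zero hx _)]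
  · have hlim := (hc.const_mul (1 / 2 + m)).add hw'
    rw [add_zero] at hlim
    refine hlim.congr' ?_
    filter_upwards [self_mem_nhdsWithin] with x hx
    rw [(hasDerivAt_cpow_mul hx (hw x hx) m).deriv,
      mul_div_cancel_left₀ _ (ofReal_cpow_ne_zero hx _)]

theorem isSolution_cpow_mul (hv : IsAC v)
    (hw : ∀ x : ℝ, 0 < x → HasDerivAt w ((x : ℂ) ^ (-1 - 2 * m) * v x) x)
    (hv' : ∀ᵐ x : ℝ, 0 < x → HasDerivAt v ((x : ℂ) ^ (1 + 2 * m) * V x * w x) x) :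
    IsSolution (besselPotential m V) fun x : ℝ => (x : ℂ) ^ (1 / 2 + m) * w x := by
  have hwac : IsAC w :=
    isAC_of_hasDerivAt hw ((continuousOn_ofReal_cpow _).mul hv.continuousOn)
  refine isSolution_of_hasDerivAt (g' := fun x : ℝ => (1 / 2 + m) * ((x : ℂ) ^ (-1 / 2 + m) * w x)
    + (x : ℂ) ^ (-1 / 2 - m) * v x) (fun x hx => ?_)
    ((((isAC_ofReal_cpow _).mul hwac).const_mul _).add ((isAC_ofReal_cpow _).mul hv)) ?_
  · refine (hasDerivAt_cpow_mul hx (hw x hx) m).congr_deriv ?_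
    have h₁ : (x : ℂ) ^ (-1 / 2 + m) * ((x : ℂ) ^ (1 : ℂ) * (x : ℂ) ^ (-1 - 2 * m)) =
        (x : ℂ) ^ (-1 / 2 - m) := by
      rw [ofReal_cpow_mul_cpow hx (c := -(2 * m)) (by ring),
        ofReal_cpow_mul_cpow hx (c := -1 / 2 - m) (by ring)]
    rw [Complex.cpow_one] at h₁
    linear_combination v x * h₁
  · filter_upwards [hv'] with x hvx hx
    refine ((((hasDerivAt_ofReal_cpow_of_pos hx (-1 / 2 + m)).mul (hw x hx)).const_mul
      (1 / 2 + m)).add ((hasDerivAt_ofReal_cpow_of_pos hx (-1 / 2 - m)).mul (hvx hx))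
        ).congr_deriv ?_
    have h₁ : (x : ℂ) ^ (-1 / 2 + m) * (x : ℂ) ^ (-1 - 2 * m) = (x : ℂ) ^ (-1 / 2 - m - 1) :=
      ofReal_cpow_mul_cpow hx (by ring)
    have h₂ : (x : ℂ) ^ (-1 / 2 - m) * (x : ℂ) ^ (1 + 2 * m) = (x : ℂ) ^ (1 / 2 + m) :=
      ofReal_cpow_mul_cpow hx (by ring)
    have h₃ : (x : ℂ) ^ (-1 / 2 + m - 1) * (x : ℂ) ^ (2 : ℂ) = (x : ℂ) ^ (1 / 2 + m) :=
      ofReal_cpow_mul_cpow hx (by ring)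
    have hx0 : (x : ℂ) ≠ 0 := Complex.ofReal_ne_zero.2 hx.ne'
    have h₄ : (m ^ 2 - 1 / 4) / (x : ℂ) ^ 2 * (x : ℂ) ^ (1 / 2 + m) =
        (m ^ 2 - 1 / 4) * (x : ℂ) ^ (-1 / 2 + m - 1) := by
      rw [← h₃, Complex.cpow_ofNat]
      field_simp
    rw [besselPotential]
    linear_combination (1 / 2 + m) * v x * h₁ + V x * w x * h₂ - w x * h₄

theorem isAC_integral {f : ℝ → ℂ} (hf : ∀ b, 0 ≤ b → IntervalIntegrable f volume 0 b) :
    IsAC fun x => ∫ s in (0 : ℝ)..x, f s := fun a b ha hb => by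
  have hab : 0 ≤ max a b := ha.le.trans (le_max_left _ _)
  exact (absolutelyContinuousOnInterval_intervalIntegral (hf _ hab)).mono (uIcc_subset_uIcc
    (mem_uIcc_of_le ha.le (le_max_left _ _)) (mem_uIcc_of_le hb.le (le_max_right _ _)))

theorem ae_hasDerivAt_integral_Ioi {f : ℝ → ℂ}
    (hf : ∀ b, 0 ≤ b → IntervalIntegrable f volume 0 b) :
    ∀ᵐ x : ℝ, 0 < x → HasDerivAt (fun x => ∫ s in (0 : ℝ)..x, f s) (f x) x := by
  filter_upwards [ae_all_iff.2 fun n : ℕ => (hf n n.cast_nonneg).ae_hasDerivAt_integral]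
    with x hx hx0
  obtain ⟨n, hn⟩ := exists_nat_ge x
  exact hx n (mem_uIcc_of_le hx0.le hn) 0 left_mem_uIcc

theorem tendsto_cpow_mul_integral (hm : 0 ≤ m.re) (hV : InL0 V)
    (hpair : IsVolterraPair (fun x : ℝ => (x : ℂ) ^ (-1 - 2 * m))
      fun x => (x : ℂ) ^ (1 + 2 * m) * V x) (hw : ContinuousOn w (Ici 0)) :
    Tendsto (fun x : ℝ => (x : ℂ) ^ (-(2 * m)) *
      ∫ s in (0 : ℝ)..x, (s : ℂ) ^ (1 + 2 * m) * V s * w s) (𝓝[>] 0) (𝓝 0) := by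
  obtain ⟨M, hM⟩ := isCompact_Icc.exists_bound_of_continuousOn
    (hw.mono (Icc_subset_Ici_self (b := 0) (a := 1)))
  have hM0 : 0 ≤ M := (norm_nonneg _).trans (hM 0 ⟨le_rfl, zero_le_one⟩)
  have hlim : Tendsto (fun x => M * ∫ s in (0 : ℝ)..x, s * ‖V s‖) (𝓝[>] 0) (𝓝 0) := by
    simpa only [mul_zero] using hV.tendsto_integral.const_mul M
  refine squeeze_zero_norm' ?_ hlim
  filter_upwards [Ioo_mem_nhdsGT one_pos] with x hx
  have hq : ∫ s in (0 : ℝ)..x, ‖(s : ℂ) ^ (1 + 2 * m) * V s‖ ≤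
      x ^ (2 * m.re) * ∫ s in (0 : ℝ)..x, s * ‖V s‖ := by
    rw [← intervalIntegral.integral_const_mul]
    refine intervalIntegral.integral_mono_on_of_le_Ioo hx.1.le
      (hpair.intervalIntegrable x hx.1.le).norm ((hV.intervalIntegrable hx.1.le).const_mul _)
      fun s hs => ?_
    rw [norm_cpow_mul_potential hs.1]
    exact mul_le_mul_of_nonneg_right (Real.rpow_le_rpow hs.1.le hs.2.le (by positivity))
      (mul_nonneg hs.1.le (norm_nonneg _))
  have hpos : 0 < x ^ (2 * m.re) := Real.rpow_pos_of_pos hx.1 _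
  rw [norm_mul, norm_ofReal_cpow hx.1 (r := -(2 * m.re)) (by simp), Real.rpow_neg hx.1.le,
    inv_mul_le_iff₀ hpos, mul_left_comm]
  exact (hpair.norm_integral_mul_le hx.1.le fun s hs => hM s ⟨hs.1, hs.2.trans hx.2.le⟩).trans
    (mul_le_mul_of_nonneg_left hq hM0)

theorem exists_isSolution_hasLeadingCoeff (hm : 0 ≤ m.re) (hV : InL0 V)
    (hpair : IsVolterraPair (fun x : ℝ => (x : ℂ) ^ (-1 - 2 * m))
      fun x => (x : ℂ) ^ (1 + 2 * m) * V x) (c : ℂ) :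
    ∃ u, IsSolution (besselPotential m V) u ∧ HasLeadingCoeff m c u := by
  obtain ⟨w, hwc, hw⟩ := hpair.exists_eq_add_op c
  have hint := hpair.intervalIntegrable_mul_continuousOn hwc
  have hwd : ∀ x : ℝ, 0 < x → HasDerivAt w ((x : ℂ) ^ (-1 - 2 * m) *
      ∫ s in (0 : ℝ)..x, (s : ℂ) ^ (1 + 2 * m) * V s * w s) x := fun x hx =>
    ((hpair.hasDerivAt_op hwc hx).const_add c).congr_of_eventuallyEq <| by
      filter_upwards [Ioi_mem_nhds hx] with y hy using hw y (le_of_lt hy)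
  have hw0 : Tendsto w (𝓝[>] 0) (𝓝 c) := by
    have h := (hwc 0 self_mem_Ici).mono_left (nhdsWithin_mono _ Ioi_subset_Ici_self)
    rwa [hw 0 le_rfl, volterraOp, intervalIntegral.integral_same, add_zero] at h
  refine ⟨_, isSolution_cpow_mul (isAC_integral hint) hwd (ae_hasDerivAt_integral_Ioi hint),
    hasLeadingCoeff_cpow_mul hwd hw0 ((tendsto_cpow_mul_integral hm hV hpair hwc).congr' ?_)⟩
  filter_upwards [self_mem_nhdsWithin] with x hx
  have hpow : (x : ℂ) ^ (1 : ℂ) * (x : ℂ) ^ (-1 - 2 * m) = (x : ℂ) ^ (-(2 * m)) :=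
    ofReal_cpow_mul_cpow hx (by ring)
  rw [← hpow, Complex.cpow_one, mul_assoc]

end LeadingCoefficient

section PrincipalSolution

variable {Q P u v : ℝ → ℂ} {m k c c₁ c₂ z : ℂ}

theorem hasFPowerSeriesOnBall_regularizedHGFun {a b : Multiset ℂ} (hab : a.card ≤ b.card) :
    HasFPowerSeriesOnBall (Complex.regularizedHGFun a b) (Complex.regularizedHGFunSeries a b)
      0 ⊤ := by
  have hr := Complex.radius_regularizedHGFunSeries_eq_top hab
  rw [← hr]
  exact (Complex.regularizedHGFunSeries a b).hasFPowerSeriesOnBall (hr ▸ ENNReal.zero_lt_top)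

theorem differentiable_regularizedHGFun {a b : Multiset ℂ} (hab : a.card ≤ b.card) :
    Differentiable ℂ (Complex.regularizedHGFun a b) := fun z =>
  ((hasFPowerSeriesOnBall_regularizedHGFun hab).analyticOnNhd z (by simp)).differentiableAt

theorem regularizedHGFun_zero {a b : Multiset ℂ} (hab : a.card ≤ b.card) :
    Complex.regularizedHGFun a b 0 = (b.map Complex.Gamma).prod⁻¹ := by
  rw [← (hasFPowerSeriesOnBall_regularizedHGFun hab).coeff_zero fun _ => 0,
    Complex.regularizedHGFunSeries, FormalMultilinearSeries.ofScalars]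
  simp [Complex.regularizedHGFunCoeff]

theorem hasLeadingCoeff_u0 (m k : ℂ) :
    HasLeadingCoeff m (Complex.Gamma (m + 1))⁻¹ (u0 m k) := by
  have hcard : (0 : Multiset ℂ).card ≤ ({m + 1} : Multiset ℂ).card := by simp
  have hF := differentiable_regularizedHGFun hcard
  have hF' : Continuous (deriv (Complex.regularizedHGFun 0 {m + 1})) :=
    (hF.contDiff (n := 1)).continuous_deriv le_rfl
  set F := Complex.regularizedHGFun 0 {m + 1}
  refine hasLeadingCoeff_cpow_mul (w := fun x : ℝ => F (k ^ 2 * (x : ℂ) ^ 2 / 4))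
    (w' := fun x : ℝ => deriv F (k ^ 2 * (x : ℂ) ^ 2 / 4) * (k ^ 2 * x / 2))
    (fun x _ => (hF _).hasDerivAt.comp x ?_) ?_ ?_
  · refine ((((hasDerivAt_id (x : ℂ)).pow 2).const_mul (k ^ 2)).div_const 4).comp_ofReal
      |>.congr_deriv ?_
    simp only [id]
    push_cast
    ring
  · have hcont : Continuous fun x : ℝ => F (k ^ 2 * (x : ℂ) ^ 2 / 4) :=
      hF.continuous.comp (by fun_prop)
    refine (hcont.tendsto' 0 _ ?_).mono_left nhdsWithin_le_nhds
    simp [F, regularizedHGFun_zero hcard]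
  · have hcont : Continuous fun x : ℝ =>
        (x : ℂ) * (deriv F (k ^ 2 * (x : ℂ) ^ 2 / 4) * (k ^ 2 * x / 2)) := by fun_prop
    exact (hcont.tendsto' 0 0 (by simp)).mono_left nhdsWithin_le_nhds

theorem isLittleO_rpow_iff {f : ℝ → ℂ} {r : ℝ} (hz : z.re = r) :
    (f =o[𝓝[>] 0] fun x : ℝ => x ^ r) ↔
      Tendsto (fun x : ℝ => f x / (x : ℂ) ^ z) (𝓝[>] 0) (𝓝 0) := by
  have hnorm : (fun x : ℝ => ‖(x : ℂ) ^ z‖) =ᶠ[𝓝[>] 0] fun x : ℝ => x ^ r := by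
    filter_upwards [self_mem_nhdsWithin] with x hx using norm_ofReal_cpow hx hz
  rw [← isLittleO_congr .rfl hnorm, isLittleO_norm_right, isLittleO_iff_tendsto']
  filter_upwards [self_mem_nhdsWithin] with x hx h0
  exact absurd h0 (ofReal_cpow_ne_zero hx z)

theorem tendsto_sub_zero_iff {f g : ℝ → ℂ} {l : Filter ℝ} (hg : Tendsto g l (𝓝 c)) :
    Tendsto (fun x => f x - g x) l (𝓝 0) ↔ Tendsto f l (𝓝 c) :=
  ⟨fun h => by simpa using h.add hg, fun h => by simpa using h.sub hg⟩

theorem isPrincipal_iff : IsPrincipal Q m k u ↔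
    IsSolution (besselPotential m fun x => Q x + k ^ 2) u ∧
      HasLeadingCoeff m (Complex.Gamma (m + 1))⁻¹ u := by
  have h0 := hasLeadingCoeff_u0 m k
  have hre : (-1 / 2 + m).re = -1 / 2 + m.re := by norm_num [Complex.div_re]
  rw [IsPrincipal, isEigensolution_iff, isLittleO_rpow_iff (z := 1 / 2 + m) (by simp),
    isLittleO_rpow_iff hre]
  simp only [sub_div, tendsto_sub_zero_iff h0.1, tendsto_sub_zero_iff h0.2, HasLeadingCoeff]

theorem HasLeadingCoeff.eventually_ne_zero (hu : HasLeadingCoeff m c u) (hc : c ≠ 0) :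
    ∀ᶠ x in 𝓝[>] 0, u x ≠ 0 :=
  (hu.1.eventually_ne hc).mono fun x hx h => hx (by rw [h, zero_div])

theorem IsSolution.wronskian_eq_zero_of_hasLeadingCoeff (hm : 0 ≤ m.re) (hu : IsSolution P u)
    (hv : IsSolution P v) (hLu : HasLeadingCoeff m c₁ u) (hLv : HasLeadingCoeff m c₂ v) {a : ℝ}
    (ha : 0 < a) : wronskian v u a = 0 := by
  have hlim := ((hLv.1.mul hLu.2).sub (hLv.2.mul hLu.1)).norm
  rw [show c₂ * ((1 / 2 + m) * c₁) - (1 / 2 + m) * c₂ * c₁ = 0 by ring, norm_zero] at hlim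
  have hle : ∀ᶠ x : ℝ in 𝓝[>] 0, ‖wronskian v u a‖ ≤
      ‖v x / (x : ℂ) ^ (1 / 2 + m) * (deriv u x / (x : ℂ) ^ (-1 / 2 + m)) -
        deriv v x / (x : ℂ) ^ (-1 / 2 + m) * (u x / (x : ℂ) ^ (1 / 2 + m))‖ := by
    filter_upwards [Ioo_mem_nhdsGT one_pos] with x hx
    have hpow : (x : ℂ) ^ (1 / 2 + m) * (x : ℂ) ^ (-1 / 2 + m) = (x : ℂ) ^ (2 * m) :=
      ofReal_cpow_mul_cpow hx.1 (by ring)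
    have hone : ‖(x : ℂ) ^ (2 * m)‖ ≤ 1 := by
      rw [norm_ofReal_cpow hx.1 (r := 2 * m.re) (by simp)]
      exact Real.rpow_le_one hx.1.le hx.2.le (by positivity)
    rw [hv.wronskian_eq hu ha hx.1, wronskian, div_mul_div_comm, div_mul_div_comm,
      mul_comm ((x : ℂ) ^ (-1 / 2 + m)), hpow, ← sub_div, norm_div]
    exact le_div_self (norm_nonneg _) (norm_pos_iff.2 (ofReal_cpow_ne_zero hx.1 _)) hone
  exact norm_le_zero_iff.1 (ge_of_tendsto hlim hle)

theorem IsSolution.eqOn_of_hasLeadingCoeff (hm : 0 ≤ m.re) (hP : LocallyIntegrableOn P (Ioi 0))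
    (hc : c ≠ 0) (hu : IsSolution P u) (hv : IsSolution P v) (hLu : HasLeadingCoeff m c u)
    (hLv : HasLeadingCoeff m c v) : EqOn v u (Ioi 0) := by
  obtain ⟨a, ha0, ha⟩ := ((hLu.eventually_ne_zero hc).and self_mem_nhdsWithin).exists
  have hvu := hv.eqOn_div_mul hu hP ha ha0
    (hu.wronskian_eq_zero_of_hasLeadingCoeff hm hv hLu hLv ha)
  have hlim : Tendsto (fun x : ℝ => v x / (x : ℂ) ^ (1 / 2 + m)) (𝓝[>] 0)
      (𝓝 (v a / u a * c)) := by
    refine (hLu.1.const_mul (v a / u a)).congr' ?_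
    filter_upwards [self_mem_nhdsWithin] with x hx
    rw [hvu hx, mul_div_assoc]
  have hone : v a / u a = 1 :=
    mul_right_cancel₀ hc ((tendsto_nhds_unique hlim hLv.1).trans (one_mul c).symm)
  exact fun x hx => by simpa only [hone, one_mul] using hvu hx

end PrincipalSolution

section VariationOfConstants

variable {g V : ℝ → ℂ} {m μ : ℂ} {x y b : ℝ}

/-- The solution `x^{1/2+μ}` of the Bessel equation with `m = ±μ` and `V = 0`. -/
noncomputable def freeSolution (μ : ℂ) (x : ℝ) : ℂ := (x : ℂ) ^ (1 / 2 + μ)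

theorem norm_freeSolution (hx : 0 < x) : ‖freeSolution μ x‖ = x ^ (1 / 2 + μ.re) :=
  norm_ofReal_cpow hx (by simp)

theorem deriv_freeSolution (hx : 0 < x) :
    deriv (freeSolution μ) x = (1 / 2 + μ) * (x : ℂ) ^ (-1 / 2 + μ) := by
  rw [show -1 / 2 + μ = 1 / 2 + μ - 1 by ring]
  exact (hasDerivAt_ofReal_cpow_of_pos hx _).deriv

theorem norm_deriv_freeSolution (hx : 0 < x) :
    ‖deriv (freeSolution μ) x‖ = ‖1 / 2 + μ‖ * x ^ (-1 / 2 + μ.re) := by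
  rw [deriv_freeSolution hx, norm_mul, norm_ofReal_cpow hx (r := -1 / 2 + μ.re)]
  norm_num [Complex.div_re]

theorem isSolution_freeSolution (h : μ ^ 2 = m ^ 2) :
    IsSolution (besselPotential m 0) (freeSolution μ) := by
  have hsol := isSolution_cpow_mul (m := μ) (V := 0) (v := fun _ => 0) (w := fun _ => 1)
    (isAC_of_hasDerivAt (fun _ _ => hasDerivAt_const _ _) continuousOn_const)
    (fun x _ => by simpa using hasDerivAt_const x (1 : ℂ))
    (.of_forall fun x _ => by simpa using hasDerivAt_const x (0 : ℂ))
  have hpot : besselPotential m 0 = besselPotential μ 0 := by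
    funext x; rw [besselPotential, besselPotential, h]
  simp only [mul_one] at hsol
  exact hpot ▸ hsol

theorem wronskian_freeSolution (hx : 0 < x) :
    wronskian (freeSolution (-m)) (freeSolution m) x = 2 * m := by
  have h₁ : (x : ℂ) ^ (1 / 2 + -m) * (x : ℂ) ^ (-1 / 2 + m) = (x : ℂ) ^ (0 : ℂ) :=
    ofReal_cpow_mul_cpow hx (by ring)
  have h₂ : (x : ℂ) ^ (-1 / 2 + -m) * (x : ℂ) ^ (1 / 2 + m) = (x : ℂ) ^ (0 : ℂ) :=
    ofReal_cpow_mul_cpow hx (by ring)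
  rw [Complex.cpow_zero] at h₁ h₂
  rw [wronskian, deriv_freeSolution hx, deriv_freeSolution hx, freeSolution, freeSolution]
  linear_combination (1 / 2 + m) * h₁ - (1 / 2 - m) * h₂

/-- The size of the two coefficients in `2m g = W(f₋,g) f₊ - W(f₊,g) f₋`, `f± = x^{1/2±m}`, weighted
so that both terms are compared with `x^{1/2-Re m}`. -/
noncomputable def amplitude (m : ℂ) (g : ℝ → ℂ) (x : ℝ) : ℝ :=
  x ^ (2 * m.re) * ‖wronskian (freeSolution (-m)) g x‖ + ‖wronskian (freeSolution m) g x‖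

theorem amplitude_nonneg (hx : 0 < x) : 0 ≤ amplitude m g x := by
  rw [amplitude]; positivity

theorem norm_le_amplitude (hx : 0 < x) :
    2 * ‖m‖ * ‖g x‖ ≤ x ^ (1 / 2 - m.re) * amplitude m g x := by
  have hpow : x ^ (1 / 2 - m.re) * x ^ (2 * m.re) = x ^ (1 / 2 + m.re) := by
    rw [← Real.rpow_add hx]; ring_nf
  have h := wronskian_mul_sub_mul g (freeSolution (-m)) (freeSolution m) x
  rw [wronskian_freeSolution hx] at h
  calc 2 * ‖m‖ * ‖g x‖ = ‖2 * m * g x‖ := by simp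
    _ ≤ ‖wronskian (freeSolution (-m)) g x‖ * ‖freeSolution m x‖ +
        ‖wronskian (freeSolution m) g x‖ * ‖freeSolution (-m) x‖ := by
      rw [← h, ← norm_mul, ← norm_mul]
      exact norm_sub_le _ _
    _ = _ := by
      rw [norm_freeSolution hx, norm_freeSolution hx, Complex.neg_re,
        ← sub_eq_add_neg, ← hpow, amplitude]
      ring

theorem norm_deriv_le_amplitude (hx : 0 < x) :
    2 * ‖m‖ * ‖deriv g x‖ ≤ (1 / 2 + ‖m‖) * x ^ (-1 / 2 - m.re) * amplitude m g x := by
  have hpow : x ^ (-1 / 2 - m.re) * x ^ (2 * m.re) = x ^ (-1 / 2 + m.re) := by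
    rw [← Real.rpow_add hx]; ring_nf
  have hnorm : ∀ μ : ℂ, ‖1 / 2 + μ‖ ≤ 1 / 2 + ‖μ‖ := fun μ =>
    (norm_add_le _ _).trans_eq (by norm_num)
  have h := wronskian_mul_deriv_sub_mul_deriv g (freeSolution (-m)) (freeSolution m) x
  rw [wronskian_freeSolution hx] at h
  calc 2 * ‖m‖ * ‖deriv g x‖ = ‖2 * m * deriv g x‖ := by simp
    _ ≤ ‖wronskian (freeSolution (-m)) g x‖ * ‖deriv (freeSolution m) x‖ +
        ‖wronskian (freeSolution m) g x‖ * ‖deriv (freeSolution (-m)) x‖ := by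
      rw [← h, ← norm_mul, ← norm_mul]
      exact norm_sub_le _ _
    _ = ‖wronskian (freeSolution (-m)) g x‖ * (‖1 / 2 + m‖ * x ^ (-1 / 2 + m.re)) +
        ‖wronskian (freeSolution m) g x‖ * (‖1 / 2 + -m‖ * x ^ (-1 / 2 - m.re)) := by
      rw [norm_deriv_freeSolution hx, norm_deriv_freeSolution hx,
        Complex.neg_re, ← sub_eq_add_neg (-1 / 2)]
    _ ≤ ‖wronskian (freeSolution (-m)) g x‖ * ((1 / 2 + ‖m‖) * x ^ (-1 / 2 + m.re)) +
        ‖wronskian (freeSolution m) g x‖ * ((1 / 2 + ‖m‖) * x ^ (-1 / 2 - m.re)) := by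
      gcongr
      · exact hnorm m
      · exact (hnorm (-m)).trans_eq (by rw [norm_neg])
    _ = _ := by rw [← hpow, amplitude]; ring

theorem continuousOn_amplitude (hg : ContinuousOn g (Ioi 0))
    (hg' : ContinuousOn (deriv g) (Ioi 0)) : ContinuousOn (amplitude m g) (Ioi 0) := by
  have hW : ∀ {μ : ℂ}, μ ^ 2 = m ^ 2 → ContinuousOn (wronskian (freeSolution μ) g) (Ioi 0) :=
    fun h => ((isSolution_freeSolution h).continuousOn.mul hg').sub
      ((isSolution_freeSolution h).continuousOn_deriv.mul hg)
  exact ((continuousOn_id.rpow_const fun x hx => .inl (ne_of_gt hx)).mul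
    (hW (neg_sq m)).norm).add (hW rfl).norm

theorem rpow_mul_norm_freeSolution_mul_le (hm : m ≠ 0) (hre : μ.re ≤ m.re) (hx : 0 < x)
    (hxy : x ≤ y) :
    x ^ (m.re - μ.re) * ‖freeSolution μ y * g y‖ ≤ y / ‖m‖ * amplitude m g y / 2 := by
  have hy : 0 < y := hx.trans_le hxy
  have : 0 < ‖m‖ := norm_pos_iff.2 hm
  have hpow : y ^ (m.re - μ.re) * y ^ (1 / 2 + μ.re) * y ^ (1 / 2 - m.re) = y := by
    rw [← Real.rpow_add hy, ← Real.rpow_add hy]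
    ring_nf
    exact Real.rpow_one y
  have hg : ‖g y‖ ≤ y ^ (1 / 2 - m.re) * amplitude m g y / (2 * ‖m‖) := by
    rw [le_div_iff₀' (by positivity)]
    exact norm_le_amplitude hy
  have : 0 ≤ m.re - μ.re := sub_nonneg.2 hre
  calc x ^ (m.re - μ.re) * ‖freeSolution μ y * g y‖
      = x ^ (m.re - μ.re) * (y ^ (1 / 2 + μ.re) * ‖g y‖) := by
        rw [norm_mul, norm_freeSolution hy]
    _ ≤ y ^ (m.re - μ.re) * (y ^ (1 / 2 + μ.re) *
          (y ^ (1 / 2 - m.re) * amplitude m g y / (2 * ‖m‖))) := by gcongr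
    _ = y ^ (m.re - μ.re) * y ^ (1 / 2 + μ.re) * y ^ (1 / 2 - m.re) / ‖m‖ *
          amplitude m g y / 2 := by ring
    _ = y / ‖m‖ * amplitude m g y / 2 := by rw [hpow]

theorem IsSolution.rpow_mul_norm_wronskian_le (hm : m ≠ 0)
    (hV : LocallyIntegrableOn V (Ioi 0)) (hg : IsSolution (besselPotential m V) g)
    (hμ : μ ^ 2 = m ^ 2) (hre : μ.re ≤ m.re) (hy : 0 < y) (hyb : y ≤ b)
    (hint : IntervalIntegrable (fun s => s * ‖V s‖ / ‖m‖ * amplitude m g s) volume y b) :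
    y ^ (m.re - μ.re) * ‖wronskian (freeSolution μ) g y‖ ≤
      b ^ (m.re - μ.re) * ‖wronskian (freeSolution μ) g b‖ +
        (∫ s in y..b, s * ‖V s‖ / ‖m‖ * amplitude m g s) / 2 := by
  set W := wronskian (freeSolution μ) g
  have hlag := (isSolution_freeSolution hμ).lagrange_identity hg
    (by simpa [besselPotential] using hV) hy (hy.trans_le hyb)
  have hpos : 0 ≤ y ^ (m.re - μ.re) := Real.rpow_nonneg hy.le _
  have hdom : ∀ s ∈ Ioc y b,
      ‖y ^ (m.re - μ.re) • ((besselPotential m V s - besselPotential m 0 s) *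
        (freeSolution μ s * g s))‖ ≤ s * ‖V s‖ / ‖m‖ * amplitude m g s / 2 := fun s hs => by
    have hVs : besselPotential m V s - besselPotential m 0 s = V s := by simp [besselPotential]
    rw [norm_smul, Real.norm_of_nonneg hpos, hVs, norm_mul]
    calc y ^ (m.re - μ.re) * (‖V s‖ * ‖freeSolution μ s * g s‖)
        = ‖V s‖ * (y ^ (m.re - μ.re) * ‖freeSolution μ s * g s‖) := by ring
      _ ≤ ‖V s‖ * (s / ‖m‖ * amplitude m g s / 2) := by
        gcongr
        exact rpow_mul_norm_freeSolution_mul_le hm hre hy hs.1.le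
      _ = _ := by ring
  have hbound := intervalIntegral.norm_integral_le_of_norm_le hyb (.of_forall hdom)
    (hint.div_const 2)
  rw [intervalIntegral.integral_smul, hlag, intervalIntegral.integral_div, norm_smul,
    Real.norm_of_nonneg hpos] at hbound
  calc y ^ (m.re - μ.re) * ‖W y‖ ≤ y ^ (m.re - μ.re) * (‖W b‖ + ‖W b - W y‖) := by
        gcongr
        exact norm_le_insert _ _
    _ ≤ b ^ (m.re - μ.re) * ‖W b‖ + y ^ (m.re - μ.re) * ‖W b - W y‖ := by
        rw [mul_add]
        gcongr
    _ ≤ _ := by gcongr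

theorem intervalIntegrable_mul_amplitude (hV : LocallyIntegrableOn V (Ioi 0))
    (hg : IsSolution (besselPotential m V) g) (hy : 0 < y) (hb : 0 < b) :
    IntervalIntegrable (fun s => s * ‖V s‖ / ‖m‖ * amplitude m g s) volume y b := by
  have hcont : ContinuousOn (fun s => s / ‖m‖ * amplitude m g s) (Ioi 0) :=
    (continuousOn_id.div_const _).mul
      (continuousOn_amplitude hg.continuousOn hg.continuousOn_deriv)
  have hloc := hV.norm.mul_continuousOn hcont isOpen_Ioi.isLocallyClosed
  refine ((hloc.integrableOn_compact_subset (uIcc_subset_Ioi hy hb)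
    isCompact_uIcc).intervalIntegrable).congr fun s _ => ?_
  ring

theorem IsSolution.amplitude_le (hr : 0 ≤ m.re) (hm : m ≠ 0)
    (hV : LocallyIntegrableOn V (Ioi 0)) (hg : IsSolution (besselPotential m V) g) (hy : 0 < y)
    (hyb : y ≤ b) :
    amplitude m g y ≤ amplitude m g b + ∫ s in y..b, s * ‖V s‖ / ‖m‖ * amplitude m g s := by
  have hint := intervalIntegrable_mul_amplitude hV hg hy (hy.trans_le hyb)
  have hneg := hg.rpow_mul_norm_wronskian_le hm hV (neg_sq m) (by rw [Complex.neg_re]; linarith)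
    hy hyb hint
  have hpos := hg.rpow_mul_norm_wronskian_le hm hV rfl le_rfl hy hyb hint
  rw [Complex.neg_re, sub_neg_eq_add, ← two_mul] at hneg
  rw [sub_self, Real.rpow_zero, Real.rpow_zero, one_mul, one_mul] at hpos
  rw [amplitude, amplitude]
  linarith

theorem IsSolution.exists_amplitude_le (hr : 0 ≤ m.re) (hm : m ≠ 0) (hV : InL0 V)
    (hg : IsSolution (besselPotential m V) g) : ∃ C, ∀ᶠ x in 𝓝[>] 0, amplitude m g x ≤ C := by
  set κ : ℝ → ℝ := fun s => s * ‖V s‖ / ‖m‖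
  have hκ : ∀ b : ℝ, 0 ≤ b → IntervalIntegrable κ volume 0 b := fun b hb =>
    (hV.intervalIntegrable hb).div_const _
  have hlim : Tendsto (fun b => ∫ s in (0 : ℝ)..b, κ s) (𝓝[>] 0) (𝓝 0) := by
    simpa only [κ, intervalIntegral.integral_div, zero_div] using
      hV.tendsto_integral.div_const ‖m‖
  have hκ0 : ∀ s : ℝ, 0 < s → 0 ≤ κ s := fun s hs => by positivity
  obtain ⟨b, hsmall, hb : 0 < b⟩ := ((hlim.eventually_le_const
    (by norm_num : (0 : ℝ) < 1 / 2)).and self_mem_nhdsWithin).exists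
  refine ⟨2 * amplitude m g b, ?_⟩
  filter_upwards [Ioo_mem_nhdsGT hb] with x hx
  have hsub := uIcc_subset_Ioi hb hx.1
  have hsmall' : |∫ s in b..x, κ s| ≤ 1 / 2 := by
    have hnn : 0 ≤ᵐ[volume.restrict (Ioc 0 b)] κ :=
      (ae_restrict_mem measurableSet_Ioc).mono fun s hs => hκ0 s hs.1
    rw [intervalIntegral.integral_symm, abs_neg, abs_of_nonneg
      (intervalIntegral.integral_nonneg hx.2.le fun s hs => hκ0 s (hx.1.trans_le hs.1))]
    exact (intervalIntegral.integral_mono_interval hx.1.le hx.2.le le_rfl hnn (hκ b hb.le)).trans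
      hsmall
  refine le_two_mul_of_le_add_abs_integral
    ((continuousOn_amplitude hg.continuousOn hg.continuousOn_deriv).mono hsub)
    (fun y hy => amplitude_nonneg (hsub hy)) ((hκ b hb.le).symm.trans (hκ x hx.1.le))
    (fun y hy => hκ0 y (hsub hy)) hsmall' fun y hy => ?_
  rw [uIcc_of_ge hx.2.le] at hy
  rw [intervalIntegral.integral_symm, abs_neg]
  exact (hg.amplitude_le hr hm hV.1 (hx.1.trans_le hy.1) hy.2).trans
    (by gcongr; exact le_abs_self _)

theorem IsSolution.isBigO (hr : 0 ≤ m.re) (hm : m ≠ 0) (hV : InL0 V)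
    (hg : IsSolution (besselPotential m V) g) :
    g =O[𝓝[>] 0] fun x : ℝ => x ^ (1 / 2 - m.re) := by
  have hm0 : 0 < 2 * ‖m‖ := by positivity
  obtain ⟨C, hC⟩ := hg.exists_amplitude_le hr hm hV
  refine .of_bound (C / (2 * ‖m‖)) ?_
  filter_upwards [hC, self_mem_nhdsWithin] with x hx (hx0 : 0 < x)
  rw [Real.norm_of_nonneg (by positivity), div_mul_eq_mul_div, le_div_iff₀' hm0, mul_comm C]
  exact (norm_le_amplitude hx0).trans (by gcongr)

theorem IsSolution.isBigO_deriv (hr : 0 ≤ m.re) (hm : m ≠ 0) (hV : InL0 V)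
    (hg : IsSolution (besselPotential m V) g) :
    deriv g =O[𝓝[>] 0] fun x : ℝ => x ^ (-1 / 2 - m.re) := by
  have hm0 : 0 < 2 * ‖m‖ := by positivity
  obtain ⟨C, hC⟩ := hg.exists_amplitude_le hr hm hV
  refine .of_bound ((1 / 2 + ‖m‖) * C / (2 * ‖m‖)) ?_
  filter_upwards [hC, self_mem_nhdsWithin] with x hx (hx0 : 0 < x)
  rw [Real.norm_of_nonneg (by positivity), div_mul_eq_mul_div, le_div_iff₀' hm0,
    mul_right_comm (1 / 2 + ‖m‖)]
  exact (norm_deriv_le_amplitude hx0).trans (by gcongr)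

end VariationOfConstants

section ReductionOfOrder

variable {P g u : ℝ → ℂ} {m c : ℂ} {a : ℝ}

theorem IsSolution.tendsto_div_cpow_mul {S : ℝ → ℂ} {ε : ℝ} (hg : IsSolution P g)
    (hu : IsSolution P u) (hL : HasLeadingCoeff m c u) (hc : c ≠ 0) (ha : 0 < a) (hε : 0 < ε)
    (hS : ∀ᶠ x : ℝ in 𝓝[>] 0, HasDerivAt S ((x : ℂ) ^ (-1 - 2 * m)) x)
    (hnorm : ∀ᶠ x : ℝ in 𝓝[>] 0,
      HasDerivAt (fun x => ‖S x‖) (-(ε * x ^ (-1 - 2 * m.re))) x)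
    (hlim : Tendsto (fun x => ‖S x‖) (𝓝[>] 0) atTop) :
    Tendsto (fun x : ℝ => g x / ((x : ℂ) ^ (1 / 2 + m) * S x)) (𝓝[>] 0)
      (𝓝 (-wronskian g u a / c)) := by
  have hquot : ∀ᶠ x in 𝓝[>] 0,
      HasDerivAt (fun y => g y / u y) (-wronskian g u a / u x ^ 2) x := by
    filter_upwards [hL.eventually_ne_zero hc, self_mem_nhdsWithin] with x hux hx
    exact hg.wronskian_eq hu ha hx ▸ hg.hasDerivAt_div hu hx hux
  have hratio : Tendsto (fun x : ℝ => -wronskian g u a / u x ^ 2 / (x : ℂ) ^ (-1 - 2 * m))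
      (𝓝[>] 0) (𝓝 (-wronskian g u a / c ^ 2)) := by
    refine (tendsto_const_nhds.div (hL.1.pow 2) (pow_ne_zero 2 hc)).congr' ?_
    filter_upwards [self_mem_nhdsWithin] with x hx
    have hsq : (x : ℂ) ^ (1 / 2 + m) * (x : ℂ) ^ (1 / 2 + m) = (x : ℂ) ^ (1 + 2 * m) :=
      ofReal_cpow_mul_cpow hx (by ring)
    rw [Pi.div_apply, div_pow, sq ((x : ℂ) ^ (1 / 2 + m)), hsq,
      show -1 - 2 * m = -(1 + 2 * m) by ring, Complex.cpow_neg, div_inv_eq_mul,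
      div_div_eq_mul_div, mul_div_right_comm]
  have hbigO : (fun x : ℝ => (x : ℂ) ^ (-1 - 2 * m)) =O[𝓝[>] 0]
      fun x : ℝ => -(ε * x ^ (-1 - 2 * m.re)) := by
    refine .of_bound ε⁻¹ ?_
    filter_upwards [self_mem_nhdsWithin] with x (hx : 0 < x)
    rw [norm_ofReal_cpow hx (r := -1 - 2 * m.re) (by simp), norm_neg,
      Real.norm_of_nonneg (by positivity), inv_mul_cancel_left₀ hε.ne']
  have hquotS := tendsto_div_of_tendsto_deriv_div hquot hS hnorm
    (eventually_mem_nhdsWithin.mono fun x (hx : 0 < x) => by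
      rw [neg_nonpos]; positivity) hlim hbigO
    (eventually_mem_nhdsWithin.mono fun x hx => ofReal_cpow_ne_zero hx _) hratio
  have hmul := hquotS.mul hL.1
  rw [show -wronskian g u a / c ^ 2 * c = -wronskian g u a / c by field_simp] at hmul
  refine hmul.congr' ((hL.eventually_ne_zero hc).mono fun x hux => ?_)
  field_simp

theorem IsSolution.tendsto_div_cpow_sub (hm : 0 < m.re) (hg : IsSolution P g)
    (hu : IsSolution P u) (hL : HasLeadingCoeff m c u) (hc : c ≠ 0) (ha : 0 < a) :
    Tendsto (fun x : ℝ => g x / (x : ℂ) ^ (1 / 2 - m)) (𝓝[>] 0)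
      (𝓝 (wronskian g u a / (2 * m * c))) := by
  have hm0 : m ≠ 0 := by rintro rfl; simp at hm
  have h2m : -(2 * m) ≠ 0 := neg_ne_zero.2 (mul_ne_zero two_ne_zero hm0)
  have : 0 < ‖m‖ := norm_pos_iff.2 hm0
  have hnorm : ∀ x : ℝ, 0 < x →
      ‖(x : ℂ) ^ (-(2 * m)) / -(2 * m)‖ = x ^ (-(2 * m.re)) / (2 * ‖m‖) := fun x hx => by
    rw [norm_div, norm_ofReal_cpow hx (r := -(2 * m.re)) (by simp)]
    simp
  have hlim := hg.tendsto_div_cpow_mul hu hL hc ha (S := fun x => (x : ℂ) ^ (-(2 * m)) / -(2 * m))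
    (ε := m.re / ‖m‖) (by positivity) ?_ ?_ ?_
  · have hmul := hlim.div_const (-(2 * m))
    rw [show -wronskian g u a / c / -(2 * m) = wronskian g u a / (2 * m * c) by
      field_simp] at hmul
    refine hmul.congr' ?_
    filter_upwards [self_mem_nhdsWithin] with x hx
    have hpow : (x : ℂ) ^ (1 / 2 + m) * (x : ℂ) ^ (-(2 * m)) = (x : ℂ) ^ (1 / 2 - m) :=
      ofReal_cpow_mul_cpow hx (by ring)
    rw [← hpow]
    field_simp
  · filter_upwards [self_mem_nhdsWithin] with x hx
    refine ((hasDerivAt_ofReal_cpow_of_pos hx (-(2 * m))).div_const _).congr_deriv ?_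
    rw [mul_div_cancel_left₀ _ h2m, neg_sub_comm]
  · filter_upwards [self_mem_nhdsWithin] with x (hx : 0 < x)
    refine (((Real.hasDerivAt_rpow_const (p := -(2 * m.re)) (.inl hx.ne')).div_const
      (2 * ‖m‖)).congr_of_eventuallyEq (eventually_of_mem (Ioi_mem_nhds hx) hnorm)).congr_deriv ?_
    rw [neg_sub_comm]
    field_simp
  · refine Tendsto.congr' (eventually_mem_nhdsWithin.mono fun x hx => (hnorm x hx).symm) ?_
    exact (tendsto_rpow_neg_nhdsGT_zero (by linarith)).atTop_div_const (by positivity)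

theorem hasDerivAt_ofReal_log {x : ℝ} (hx : 0 < x) :
    HasDerivAt (fun x : ℝ => (Real.log x : ℂ)) ((x : ℂ) ^ (-1 - 2 * (0 : ℂ))) x := by
  simpa [Complex.cpow_neg_one] using (Real.hasDerivAt_log hx.ne').ofReal_comp

theorem IsSolution.tendsto_div_sqrt_mul_log (hg : IsSolution P g) (hu : IsSolution P u)
    (hL : HasLeadingCoeff 0 c u) (hc : c ≠ 0) (ha : 0 < a) :
    Tendsto (fun x : ℝ => g x / ((x : ℂ) ^ (1 / 2 : ℂ) * Real.log x)) (𝓝[>] 0)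
      (𝓝 (-wronskian g u a / c)) := by
  have hlog : Tendsto (fun x : ℝ => -Real.log x) (𝓝[>] 0) atTop :=
    tendsto_neg_atBot_atTop.comp Real.tendsto_log_nhdsGT_zero
  have hnorm : ∀ x ∈ Ioo (0 : ℝ) 1, ‖(Real.log x : ℂ)‖ = -Real.log x := fun x hx => by
    rw [Complex.norm_real, Real.norm_of_nonpos (Real.log_neg hx.1 hx.2).le]
  have hlim := hg.tendsto_div_cpow_mul hu hL hc ha (S := fun x => (Real.log x : ℂ)) one_pos
    (eventually_mem_nhdsWithin.mono fun x hx => hasDerivAt_ofReal_log hx) ?_ ?_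
  · simpa only [add_zero] using hlim
  · filter_upwards [Ioo_mem_nhdsGT one_pos] with x hx
    refine ((Real.hasDerivAt_log hx.1.ne').neg.congr_of_eventuallyEq
      (eventually_of_mem (Ioo_mem_nhds hx.1 hx.2) hnorm)).congr_deriv ?_
    simp [Real.rpow_neg_one]
  · exact hlog.congr' (eventually_of_mem (Ioo_mem_nhdsGT one_pos) fun x hx => (hnorm x hx).symm)

theorem IsSolution.tendsto_deriv_div_rpow_mul_log (hg : IsSolution P g) (hu : IsSolution P u)
    (hL : HasLeadingCoeff 0 c u) (hc : c ≠ 0) (ha : 0 < a) :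
    Tendsto (fun x : ℝ => deriv g x / ((x : ℂ) ^ (-1 / 2 : ℂ) * Real.log x)) (𝓝[>] 0)
      (𝓝 (-wronskian g u a / (2 * c))) := by
  have hlog : Tendsto (fun x : ℝ => ((Real.log x)⁻¹ : ℂ)) (𝓝[>] 0) (𝓝 0) := by
    have h := Real.tendsto_log_nhdsGT_zero.inv_tendsto_atBot
    exact_mod_cast (Complex.continuous_ofReal.tendsto 0).comp h
  have hLu := hL.1
  have hLu' := hL.2
  simp only [add_zero] at hLu hLu'
  have hlim := (((hg.tendsto_div_sqrt_mul_log hu hL hc ha).mul hLu').div hLu hc).sub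
    ((hLu.inv₀ hc).const_mul (wronskian g u a) |>.mul hlog)
  rw [show -wronskian g u a / c * (1 / 2 * c) / c - wronskian g u a * c⁻¹ * 0 =
    -wronskian g u a / (2 * c) by field_simp; ring] at hlim
  refine hlim.congr' ?_
  filter_upwards [hL.eventually_ne_zero hc, Ioo_mem_nhdsGT one_pos] with x hux hx
  have hpow : (x : ℂ) ^ (1 / 2 : ℂ) * (x : ℂ) ^ (-1 / 2 : ℂ) = 1 := by
    rw [ofReal_cpow_mul_cpow hx.1 (c := 0) (by norm_num), Complex.cpow_zero]
  have hlog0 : (Real.log x : ℂ) ≠ 0 := Complex.ofReal_ne_zero.2 (Real.log_neg hx.1 hx.2).ne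
  have := ofReal_cpow_ne_zero hx.1 (-1 / 2)
  rw [Pi.div_apply, hg.wronskian_eq hu ha hx.1, wronskian, eq_inv_of_mul_eq_one_left hpow]
  field_simp
  ring

end ReductionOfOrder

section Eigensolutions

variable {Q g u v : ℝ → ℂ} {m k : ℂ}

theorem inv_gamma_add_one_ne_zero (hm : 0 ≤ m.re) : (Complex.Gamma (m + 1))⁻¹ ≠ 0 :=
  inv_ne_zero (Complex.Gamma_ne_zero_of_re_pos (by rw [Complex.add_re, Complex.one_re]; linarith))

theorem IsEigensolution.isBigO (hm : 0 ≤ m.re) (hm0 : m ≠ 0) (hQ : InL0 Q)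
    (hg : IsEigensolution Q m k g) :
    (g =O[𝓝[>] 0] fun x : ℝ => x ^ (1 / 2 - m.re)) ∧
      deriv g =O[𝓝[>] 0] fun x : ℝ => x ^ (-1 / 2 - m.re) := by
  have hV := hQ.add_const (k ^ 2)
  have hsol := isEigensolution_iff.1 hg
  exact ⟨hsol.isBigO hm hm0 hV, hsol.isBigO_deriv hm hm0 hV⟩

theorem exists_isPrincipal_of_re_pos (hm : 0 < m.re) (hQ : InL0 Q) (k : ℂ) :
    ∃ u, IsPrincipal Q m k u := by
  have hV := hQ.add_const (k ^ 2)
  obtain ⟨u, hu⟩ := exists_isSolution_hasLeadingCoeff hm.le hV (isVolterraPair_of_re_pos hm hV) _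
  exact ⟨u, isPrincipal_iff.2 hu⟩

theorem exists_isPrincipal_zero (hQ : InL0Log Q) (k : ℂ) : ∃ u, IsPrincipal Q 0 k u := by
  have hV := hQ.add_const (k ^ 2)
  obtain ⟨u, hu⟩ := exists_isSolution_hasLeadingCoeff le_rfl hV.inL0 (isVolterraPair_zero hV) _
  exact ⟨u, isPrincipal_iff.2 hu⟩

theorem IsPrincipal.eqOn (hm : 0 ≤ m.re) (hQ : LocallyIntegrableOn Q (Ioi 0))
    (hu : IsPrincipal Q m k u) (hv : IsPrincipal Q m k v) : EqOn v u (Ioi 0) := by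
  obtain ⟨hus, hLu⟩ := isPrincipal_iff.1 hu
  obtain ⟨hvs, hLv⟩ := isPrincipal_iff.1 hv
  exact hus.eqOn_of_hasLeadingCoeff hm
    (locallyIntegrableOn_besselPotential (locallyIntegrableOn_add_const hQ _))
    (inv_gamma_add_one_ne_zero hm) hvs hLu hLv

theorem IsPrincipal.wronskian_ne_zero (hQ : LocallyIntegrableOn Q (Ioi 0))
    (hu : IsPrincipal Q m k u) (hg : IsEigensolution Q m k g) (hgu : IndependentOnHalfLine g u)
    {a : ℝ} (ha : 0 < a) : wronskian g u a ≠ 0 :=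
  hgu.wronskian_ne_zero (isEigensolution_iff.1 hg) (isPrincipal_iff.1 hu).1
    (locallyIntegrableOn_besselPotential (locallyIntegrableOn_add_const hQ _)) ha

theorem IsPrincipal.exists_tendsto_div_cpow (hm : 0 < m.re)
    (hQ : LocallyIntegrableOn Q (Ioi 0)) (hu : IsPrincipal Q m k u)
    (hg : IsEigensolution Q m k g) (hgu : IndependentOnHalfLine g u) :
    ∃ c : ℂ, c ≠ 0 ∧ Tendsto (fun x : ℝ => g x / (x : ℂ) ^ (1 / 2 - m)) (𝓝[>] 0) (𝓝 c) := by
  obtain ⟨hus, hL⟩ := isPrincipal_iff.1 hu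
  have hc := inv_gamma_add_one_ne_zero hm.le
  have hm0 : m ≠ 0 := by rintro rfl; exact hm.ne rfl
  exact ⟨_, div_ne_zero (hu.wronskian_ne_zero hQ hg hgu one_pos)
      (mul_ne_zero (mul_ne_zero two_ne_zero hm0) hc),
    (isEigensolution_iff.1 hg).tendsto_div_cpow_sub hm hus hL hc one_pos⟩

theorem ofReal_rpow_mul_log {x : ℝ} (hx : 0 < x) (r : ℝ) :
    ((x ^ r * Real.log x : ℝ) : ℂ) = (x : ℂ) ^ (r : ℂ) * Real.log x := by
  rw [Complex.ofReal_mul, Complex.ofReal_cpow hx.le]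

theorem IsPrincipal.exists_tendsto_div_log (hQ : LocallyIntegrableOn Q (Ioi 0))
    (hu : IsPrincipal Q 0 k u) (hg : IsEigensolution Q 0 k g)
    (hgu : IndependentOnHalfLine g u) :
    ∃ c : ℂ, c ≠ 0 ∧
      Tendsto (fun x : ℝ => g x / ((x ^ (1 / 2 : ℝ) * Real.log x : ℝ) : ℂ)) (𝓝[>] 0) (𝓝 c) := by
  obtain ⟨hus, hL⟩ := isPrincipal_iff.1 hu
  have hc := inv_gamma_add_one_ne_zero (m := 0) le_rfl
  refine ⟨_, div_ne_zero (neg_ne_zero.2 (hu.wronskian_ne_zero hQ hg hgu one_pos)) hc,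
    ((isEigensolution_iff.1 hg).tendsto_div_sqrt_mul_log hus hL hc one_pos).congr' ?_⟩
  filter_upwards [self_mem_nhdsWithin] with x hx
  rw [ofReal_rpow_mul_log hx]
  norm_num

theorem isBigO_rpow_mul_log {f : ℝ → ℂ} {r : ℝ} {c : ℂ}
    (h : Tendsto (fun x : ℝ => f x / ((x : ℂ) ^ (r : ℂ) * Real.log x)) (𝓝[>] 0) (𝓝 c)) :
    f =O[𝓝[>] 0] fun x : ℝ => x ^ r * Real.log x := by
  rw [← Complex.isBigO_ofReal_right]
  refine isBigO_of_div_tendsto_nhds ?_ c (h.congr' ?_)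
  · filter_upwards [Ioo_mem_nhdsGT one_pos] with x hx h0
    exact absurd (Complex.ofReal_eq_zero.1 h0)
      (mul_ne_zero (Real.rpow_pos_of_pos hx.1 r).ne' (Real.log_neg hx.1 hx.2).ne)
  · filter_upwards [self_mem_nhdsWithin] with x hx
    rw [Pi.div_apply, ofReal_rpow_mul_log hx]

theorem IsEigensolution.isBigO_log (hQ : InL0Log Q) (hg : IsEigensolution Q 0 k g) :
    (g =O[𝓝[>] 0] fun x : ℝ => x ^ (1 / 2 : ℝ) * Real.log x) ∧
      deriv g =O[𝓝[>] 0] fun x : ℝ => x ^ (-1 / 2 : ℝ) * Real.log x := by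
  obtain ⟨u, hu⟩ := exists_isPrincipal_zero hQ k
  obtain ⟨hus, hL⟩ := isPrincipal_iff.1 hu
  have hsol := isEigensolution_iff.1 hg
  have hc := inv_gamma_add_one_ne_zero (m := 0) le_rfl
  refine ⟨isBigO_rpow_mul_log (c := -wronskian g u 1 / (Complex.Gamma (0 + 1))⁻¹) ?_,
    isBigO_rpow_mul_log (c := -wronskian g u 1 / (2 * (Complex.Gamma (0 + 1))⁻¹)) ?_⟩
  · simpa using hsol.tendsto_div_sqrt_mul_log hus hL hc one_pos
  · simpa using hsol.tendsto_deriv_div_rpow_mul_log hus hL hc one_pos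

end Eigensolutions

end PerturbedBessel

theorem mainTheorem3 (Q : ℝ → ℂ) (k : ℂ) (hk : 0 ≤ k.re) :
    -- (i) the case `Re m ≥ 0`, `m ≠ 0`
    (∀ m : ℂ, 0 ≤ m.re → m ≠ 0 → PerturbedBessel.InL0 Q →
      (∀ g : ℝ → ℂ, PerturbedBessel.IsEigensolution Q m k g →
        g =O[𝓝[>] 0] (fun x : ℝ => x ^ (1 / 2 - m.re)) ∧
        deriv g =O[𝓝[>] 0] (fun x : ℝ => x ^ (-1 / 2 - m.re))) ∧
      (0 < m.re →
        -- `u` is `u_m(·,k)`, which exists and is unique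
        ∃ u : ℝ → ℂ, PerturbedBessel.IsPrincipal Q m k u ∧
          (∀ v : ℝ → ℂ, PerturbedBessel.IsPrincipal Q m k v → EqOn v u (Ioi 0)) ∧
          ∀ g : ℝ → ℂ, PerturbedBessel.IsEigensolution Q m k g →
            PerturbedBessel.IndependentOnHalfLine g u →
            ∃ c : ℂ, c ≠ 0 ∧
              Tendsto (fun x : ℝ => g x / (x : ℂ) ^ (1 / 2 - m)) (𝓝[>] 0) (𝓝 c))) ∧
    -- (ii) the case `m = 0`
    (PerturbedBessel.InL0Log Q →
      (∀ g : ℝ → ℂ, PerturbedBessel.IsEigensolution Q 0 k g →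
        g =O[𝓝[>] 0] (fun x : ℝ => x ^ (1 / 2 : ℝ) * Real.log x) ∧
        deriv g =O[𝓝[>] 0] (fun x : ℝ => x ^ (-1 / 2 : ℝ) * Real.log x)) ∧
      ∃ u : ℝ → ℂ, PerturbedBessel.IsPrincipal Q 0 k u ∧
        (∀ v : ℝ → ℂ, PerturbedBessel.IsPrincipal Q 0 k v → EqOn v u (Ioi 0)) ∧
        ∀ g : ℝ → ℂ, PerturbedBessel.IsEigensolution Q 0 k g →
          PerturbedBessel.IndependentOnHalfLine g u →
          ∃ c : ℂ, c ≠ 0 ∧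
            Tendsto (fun x : ℝ => g x / ((x ^ (1 / 2 : ℝ) * Real.log x : ℝ) : ℂ))
              (𝓝[>] 0) (𝓝 c)) := by
  refine ⟨fun m hm hm0 hQ => ⟨fun g hg => hg.isBigO hm hm0 hQ, fun hpos => ?_⟩,
    fun hQ => ⟨fun g hg => hg.isBigO_log hQ, ?_⟩⟩
  · obtain ⟨u, hu⟩ := PerturbedBessel.exists_isPrincipal_of_re_pos hpos hQ k
    exact ⟨u, hu, fun v hv => hu.eqOn hm hQ.1 hv, fun g hg hgu =>
      hu.exists_tendsto_div_cpow hpos hQ.1 hg hgu⟩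
  · obtain ⟨u, hu⟩ := PerturbedBessel.exists_isPrincipal_zero hQ k
    exact ⟨u, hu, fun v hv => hu.eqOn le_rfl hQ.1 hv, fun g hg hgu =>
      hu.exists_tendsto_div_log hQ.1 hg hgu⟩
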